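/- For $q\ge 1$, $d\in\{1,2,\dots\}$ and $t>0$ put $B_t^q=\{x\in\mathbb{R}^d:\sum_{i=1}^d|x_i|^q\le t^q\}$ and $\kappa_q(d,t)=t\,d^{-1/q}$. Identify $\mathbb{T}^d$ with $[-\tfrac12,\tfrac12)^d$ and for $\xi\in\mathbb{T}^d$ let $$\|\xi\|=\Big(\sum_{j=1}^d\sin^2(\pi\xi_j)\Big)^{1/2},\qquad \|\xi+1/2\|=\Big(\sum_{j=1}^d\cos^2(\pi\xi_j)\Big)^{1/2},$$ $$m_t^q(\xi)=\frac{1}{|B_t^q\cap\mathbb{Z}^d|}\sum_{x\in B_t^q\cap\mathbb{Z}^d}e^{2\pi i\,x\cdot\xi},\qquad \lambda_t^{1,q}(\xi)=e^{-\kappa_q(d,t)^q\|\xi\|^2},$$ $$\lambda_t^{2,q}(\xi)=\frac{1}{|B_t^q\cap\mathbb{Z}^d|}\Big(\sum_{x\in B_t^q\cap\mathbb{Z}^d}(-1)^{\sum_{i=1}^d x_i}\Big)e^{-\kappa_q(d,t)^q\|\xi+1/2\|^2}.$$ There is an absolute constant $C>0$ such that for all real $q\ge1$, all integers $d,N\ge1$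 with $\kappa_q(d,N)\le e^{-12/q}$, and all $\xi\in\mathbb{T}^d$, the following hold. (1) If $\|\xi\|\le\|\xi+1/2\|$, then $$|m_N^q(\xi)-\lambda_N^{1,q}(\xi)|\le C\Big(\min\big(\kappa_q(d,N)^q\|\xi\|^2,\ (\kappa_q(d,N)^q\|\xi\|^2)^{-1}\big)+\kappa_q(d,N)^{q/50}+N^{-q}\Big).$$ (2) If $\|\xi+1/2\|<\|\xi\|$, then $$|m_N^q(\xi)-\lambda_N^{2,q}(\xi)|\le C\Big(\min\big(\kappa_q(d,N)^q\|\xi+1/2\|^2,\ (\kappa_q(d,N)^q\|\xi+1/2\|^2)^{-1}\big)+\kappa_q(d,N)^{q/50}+N^{-q}\Big).$$ Here a minimum $\min(0,0^{-1})$ is read as $0$. -/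

import Mathlib

noncomputable section

namespace LqBall

/-- The `d`-dimensional torus, identified with `[-1/2, 1/2)^d`. -/
def torus (d : ℕ) : Set (Fin d → ℝ) :=
  {ξ | ∀ i, ξ i ∈ Set.Ico (-(1 / 2) : ℝ) (1 / 2)}

/-- The closed `ℓ^q` ball `B_t^q` of radius `t` in `ℝ^d`. -/
def ball (q : ℝ) (d : ℕ) (t : ℝ) : Set (Fin d → ℝ) :=
  {x | ∑ i, |x i| ^ q ≤ t ^ q}

/-- The set `B_t^q ∩ ℤ^d`. -/
def latticeBall (q : ℝ) (d : ℕ) (t : ℝ) : Set (Fin d → ℤ) :=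
  {x | (fun i => (x i : ℝ)) ∈ ball q d t}

/-- `B_t^q ∩ ℤ^d` is finite, so the cardinalities and sums below are genuine ones. -/
theorem latticeBall_finite {q : ℝ} (hq : 1 ≤ q) (d : ℕ) {t : ℝ} (ht : 0 ≤ t) :
    (latticeBall q d t).Finite := by
  have hq0 : 0 < q := by linarith
  refine (Set.Finite.pi' (fun _ : Fin d => Set.finite_Icc (-⌊t⌋) ⌊t⌋)).subset ?_
  intro x hx i
  have h1 : |(x i : ℝ)| ^ q ≤ t ^ q := by
    refine le_trans ?_ hx
    exact Finset.single_le_sum (f := fun j => |(x j : ℝ)| ^ q)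
      (fun j _ => Real.rpow_nonneg (abs_nonneg _) q) (Finset.mem_univ i)
  have h2 : |(x i : ℝ)| ≤ t := (Real.rpow_le_rpow_iff (abs_nonneg _) ht hq0).1 h1
  have h3 : |x i| ≤ ⌊t⌋ := by
    rw [Int.le_floor]
    push_cast
    exact h2
  exact Set.mem_Icc.2 (abs_le.1 h3)

/-- `κ_q(d,t) = t / d^{1/q}`. -/
def kappa (q : ℝ) (d : ℕ) (t : ℝ) : ℝ :=
  t / (d : ℝ) ^ (1 / q)

/-- `‖ξ‖ = (∑_j sin²(π ξ_j))^{1/2}`; it is 1-periodic in every coordinate. -/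
def tnorm {d : ℕ} (ξ : Fin d → ℝ) : ℝ :=
  Real.sqrt (∑ j, Real.sin (Real.pi * ξ j) ^ 2)

/-- `ξ + 1/2 = (ξ_1 + 1/2, …, ξ_d + 1/2)`. -/
def halfShift {d : ℕ} (ξ : Fin d → ℝ) : Fin d → ℝ :=
  fun j => ξ j + 1 / 2

/-- `e(s) = e^{2πis}`. -/
def e (s : ℝ) : ℂ :=
  Complex.exp (2 * Real.pi * Complex.I * s)

/-- The multiplier `m_t^q(ξ)`, the average of `e(x · ξ)` over `x ∈ B_t^q ∩ ℤ^d`. -/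
def mult (q : ℝ) {d : ℕ} (t : ℝ) (ξ : Fin d → ℝ) : ℂ :=
  (1 / ((latticeBall q d t).ncard : ℂ)) *
    ∑ᶠ x ∈ latticeBall q d t, e (∑ i, (x i : ℝ) * ξ i)

/-- `λ_t^{1,q}(ξ) = exp(-κ_q(d,t)^q ‖ξ‖²)`. -/
def lambda1 (q : ℝ) {d : ℕ} (t : ℝ) (ξ : Fin d → ℝ) : ℂ :=
  (Real.exp (-(kappa q d t ^ q * tnorm ξ ^ 2)) : ℂ)

/-- `λ_t^{2,q}(ξ)`, the average of `(-1)^{x_1 + ⋯ + x_d}` over `x ∈ B_t^q ∩ ℤ^d` times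
`exp(-κ_q(d,t)^q ‖ξ + 1/2‖²)`. -/
def lambda2 (q : ℝ) {d : ℕ} (t : ℝ) (ξ : Fin d → ℝ) : ℂ :=
  (1 / ((latticeBall q d t).ncard : ℂ)) *
    (∑ᶠ x ∈ latticeBall q d t, (-1 : ℂ) ^ (∑ i, x i)) *
    (Real.exp (-(kappa q d t ^ q * tnorm (halfShift ξ) ^ 2)) : ℂ)

end LqBall

end

/-! ### Counting lattice points: coordinates of a typical point of the ball. -/

noncomputable section

namespace LqBall

open Finset

/-! Write `n = N^q` and `K = n / d = κ^q`, which is below `1/1000`. The ball is invariant under sign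
changes, so the multiplier is the average over the ball of `cosProd ξ x = ∏ cos (2π x_i ξ_i)`.
Shifting `ξ` by `1/2` multiplies this product by `(-1)^(∑ x_i)`, so both cases reduce to one
statement about `η`, the one of `ξ` and `ξ + 1/2` with the smaller norm. Put `s = K ‖η‖²`. The
Gaussian is never matched precisely: it suffices that it and the average are comparable at both
ends.

For small `s`, `exp (-s)` is within `s` of `1`, and so is the average of `cosProd η` up to a
constant factor, since a coordinate has second moment `O(K)` (`sum_abs_one_sub_cosProd_le`).

For large `s`, `exp (-s) ≤ 1/s`, and the average of `cosProd ξ` is `O(1/s + K + 1/n)`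
(`abs_sum_cosProd_le`). Indeed, all but `O(K)` of the points have at least `n/2` coordinates equal
to `±1` (`card_few_ones_le`), and almost all coordinates vanish. Permutation invariance allows
averaging over the placement of the frequencies. Pairing each `±1` coordinate with a vanishing one
and symmetrizing over the transposition turns the factor `a_u = cos (2π ξ_u)` into `(a_u + a_v) /
2`, which is at most `exp (-(1 - a_u a_v) / 4)` in absolute value. The total exponent has mean at
least of order `s`, and a second moment bound makes it concentrate there (`abs_sum_perm_prod_le`).
-/

/-- The sum `∑ |x_i|^q` of a lattice point. -/
def qsum (q : ℝ) {d : ℕ} (x : Fin d → ℤ) : ℝ := ∑ i, |(x i : ℝ)| ^ q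

/-- The lattice ball as a finset. -/
def ballFinset {q : ℝ} (hq : 1 ≤ q) (d N : ℕ) : Finset (Fin d → ℤ) :=
  (latticeBall_finite hq d (Nat.cast_nonneg N)).toFinset

section Counting

variable {q : ℝ} (hq : 1 ≤ q) {d N : ℕ}

lemma mem_ballFinset {x : Fin d → ℤ} : x ∈ ballFinset hq d N ↔ qsum q x ≤ (N : ℝ) ^ q := by
  simp [ballFinset, latticeBall, ball, qsum]

lemma zero_mem_ballFinset : (0 : Fin d → ℤ) ∈ ballFinset hq d N := by
  rw [mem_ballFinset]
  have : q ≠ 0 := by linarith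
  simp only [qsum, Pi.zero_apply, Int.cast_zero, abs_zero, Real.zero_rpow this, sum_const_zero]
  positivity

lemma card_ballFinset_pos : 0 < ((ballFinset hq d N).card : ℝ) := by
  exact_mod_cast card_pos.2 ⟨0, zero_mem_ballFinset hq⟩

lemma one_le_abs_rpow {q : ℝ} (hq : 1 ≤ q) {j : ℤ} (hj : j ≠ 0) : 1 ≤ |(j : ℝ)| ^ q := by
  apply Real.one_le_rpow _ (by linarith)
  exact_mod_cast Int.one_le_abs hj

lemma card_support_le_qsum {q : ℝ} (hq : 1 ≤ q) {d : ℕ} (x : Fin d → ℤ) :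
    ((univ.filter fun i => x i ≠ 0).card : ℝ) ≤ qsum q x := by
  rw [card_eq_sum_ones, Nat.cast_sum, sum_filter, qsum]
  refine sum_le_sum fun i _ => ?_
  split_ifs with h
  · simpa using one_le_abs_rpow hq h
  · positivity

lemma qsum_update (x : Fin d → ℤ) (i : Fin d) (j : ℤ) :
    qsum q (Function.update x i j) = qsum q x - |(x i : ℝ)| ^ q + |(j : ℝ)| ^ q := by
  unfold qsum
  rw [← add_sum_erase _ _ (mem_univ i), ← add_sum_erase univ (fun i => |(x i : ℝ)| ^ q) (mem_univ i)]
  have : ∑ k ∈ univ.erase i, |((Function.update x i j k : ℤ) : ℝ)| ^ q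
      = ∑ k ∈ univ.erase i, |(x k : ℝ)| ^ q :=
    sum_congr rfl fun k hk => by rw [Function.update_of_ne (ne_of_mem_erase hk)]
  rw [this, Function.update_self]
  ring

/-- Points of the ball vanishing on `S` with `∑ |x_i|^q ≤ T`. -/
def subBall (d N : ℕ) (S : Finset (Fin d)) (T : ℝ) : Finset (Fin d → ℤ) :=
  (ballFinset hq d N).filter fun x => (∀ i ∈ S, x i = 0) ∧ qsum q x ≤ T

lemma mem_subBall {S : Finset (Fin d)} {T : ℝ} (hT : T ≤ (N : ℝ) ^ q) {x : Fin d → ℤ} :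
    x ∈ subBall hq d N S T ↔ (∀ i ∈ S, x i = 0) ∧ qsum q x ≤ T := by
  simp only [subBall, mem_filter, mem_ballFinset, and_iff_right_iff_imp, and_imp]
  intro _ h
  exact h.trans hT

/-- Placing a `1` at a vanishing coordinate shows that lowering the radius by one costs a factor. -/
lemma card_subBall_sub_one_mul_le (S : Finset (Fin d)) {T : ℝ} (hT : T ≤ (N : ℝ) ^ q) :
    (subBall hq d N S (T - 1)).card * (d - S.card - ⌊(N : ℝ) ^ q⌋₊)
      ≤ (subBall hq d N S T).card * ⌊(N : ℝ) ^ q⌋₊ := by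
  classical
  have hq0 : q ≠ 0 := by linarith
  have hsupp : ∀ x : Fin d → ℤ, qsum q x ≤ (N : ℝ) ^ q →
      (univ.filter fun i => x i ≠ 0).card ≤ ⌊(N : ℝ) ^ q⌋₊ := fun x hx =>
    Nat.le_floor ((card_support_le_qsum hq x).trans hx)
  -- Double counting: `x` has a neighbour for each coordinate outside `S` and outside its support,
  -- while `y` arises only by erasing one of its at most `⌊N^q⌋` nonzero entries.
  refine card_mul_le_card_mul
    (fun x y : Fin d → ℤ => ∃ k, k ∉ S ∧ x k = 0 ∧ y = Function.update x k 1) ?_ ?_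
  · intro x hx
    rw [mem_subBall hq (by linarith)] at hx
    have h1 : ((univ \ S) \ univ.filter fun i => x i ≠ 0).card ≤
        ((subBall hq d N S T).bipartiteAbove
          (fun x y : Fin d → ℤ => ∃ k, k ∉ S ∧ x k = 0 ∧ y = Function.update x k 1) x).card := by
      refine card_le_card_of_injOn (fun k => Function.update x k 1) ?_ ?_
      · intro k hk
        have hk' : k ∉ S ∧ x k = 0 := by simpa using hk
        simp only [coe_bipartiteAbove, Set.mem_ofPred_eq]
        refine ⟨?_, k, hk'.1, hk'.2, rfl⟩
        rw [mem_subBall hq hT, qsum_update, hk'.2]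
        refine ⟨fun i hi => ?_, ?_⟩
        · rw [Function.update_of_ne (by rintro rfl; exact hk'.1 hi)]
          exact hx.1 i hi
        · simp [Real.zero_rpow hq0]; linarith [hx.2]
      · intro k hk l hl hkl
        by_contra hne
        have hk' : k ∉ S ∧ x k = 0 := by simpa using hk
        have := congrFun hkl k
        simp [Function.update_of_ne hne, hk'.2] at this
    refine le_trans ?_ h1
    refine le_trans ?_ (le_card_sdiff _ _)
    rw [card_sdiff_of_subset (subset_univ _), card_univ, Fintype.card_fin]
    exact Nat.sub_le_sub_left (hsupp x (by linarith [hx.2])) _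
  · intro y hy
    rw [mem_subBall hq hT] at hy
    refine le_trans ?_ (hsupp y (hy.2.trans hT))
    refine (card_le_card (t := (univ.filter fun i => y i ≠ 0).image
      fun k => Function.update y k 0) ?_).trans card_image_le
    intro x hx
    rw [mem_bipartiteBelow] at hx
    obtain ⟨-, k, -, hk, rfl⟩ := hx
    refine mem_image.2 ⟨k, by simp, ?_⟩
    simp [← hk]

/-- The quantity `κ^q = N^q / d`. -/
def dens (q : ℝ) (d N : ℕ) : ℝ := (N : ℝ) ^ q / d

lemma one_le_pow_q {q : ℝ} (hq : 1 ≤ q) {N : ℕ} (hN : 1 ≤ N) : 1 ≤ (N : ℝ) ^ q :=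
  Real.one_le_rpow (by exact_mod_cast hN) (by linarith)

lemma d_large (hd : 1 ≤ d) (hK : dens q d N ≤ 1 / 1000) : 1000 * (N : ℝ) ^ q ≤ d := by
  have : (0 : ℝ) < d := by exact_mod_cast hd
  rw [dens, div_le_iff₀ this] at hK
  linarith

lemma card_subBall_sub_one_le (hd : 1 ≤ d) (hN : 1 ≤ N) (hK : dens q d N ≤ 1 / 1000)
    {S : Finset (Fin d)} (hS : S.card ≤ 1) {T : ℝ} (hT : T ≤ (N : ℝ) ^ q) :
    ((subBall hq d N S (T - 1)).card : ℝ) ≤ 2 * dens q d N * (subBall hq d N S T).card := by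
  have h := card_subBall_sub_one_mul_le hq S hT
  have hd0 : (0 : ℝ) < d := by exact_mod_cast hd
  have hbig := d_large hd hK
  have hn1 := one_le_pow_q hq hN
  have hfl : (⌊(N : ℝ) ^ q⌋₊ : ℝ) ≤ (N : ℝ) ^ q := Nat.floor_le (by linarith)
  have h' : ((subBall hq d N S (T - 1)).card : ℝ) * ((d - S.card - ⌊(N : ℝ) ^ q⌋₊ : ℕ) : ℝ)
      ≤ (subBall hq d N S T).card * (⌊(N : ℝ) ^ q⌋₊ : ℝ) := by exact_mod_cast h
  -- As `d ≥ 1000 N^q ≥ 1000`, discarding `S` and a support leaves at least half of the coordinates.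
  have h2 : (d : ℝ) / 2 ≤ ((d - S.card - ⌊(N : ℝ) ^ q⌋₊ : ℕ) : ℝ) := by
    have e1 : (d : ℝ) ≤ ((d - S.card - ⌊(N : ℝ) ^ q⌋₊ : ℕ) : ℝ) + 1 + ⌊(N : ℝ) ^ q⌋₊ := by
      exact_mod_cast (by omega : d ≤ (d - S.card - ⌊(N : ℝ) ^ q⌋₊) + 1 + ⌊(N : ℝ) ^ q⌋₊)
    linarith
  have h3 : ((subBall hq d N S (T - 1)).card : ℝ) * (d / 2)
      ≤ (subBall hq d N S T).card * (N : ℝ) ^ q :=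
    (mul_le_mul_of_nonneg_left h2 (by positivity)).trans
      (h'.trans (mul_le_mul_of_nonneg_left hfl (by positivity)))
  rw [dens, mul_div_assoc', div_mul_eq_mul_div, le_div_iff₀ hd0]
  linarith

lemma dens_nonneg : 0 ≤ dens q d N := by unfold dens; positivity

lemma card_subBall_sub_nat_le (hd : 1 ≤ d) (hN : 1 ≤ N) (hK : dens q d N ≤ 1 / 1000)
    {S : Finset (Fin d)} (hS : S.card ≤ 1) (m : ℕ) :
    ((subBall hq d N S ((N : ℝ) ^ q - m)).card : ℝ)
      ≤ (2 * dens q d N) ^ m * (ballFinset hq d N).card := by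
  induction m with
  | zero =>
    simp only [pow_zero, one_mul]
    exact_mod_cast card_le_card (filter_subset _ _)
  | succ m ih =>
    have := card_subBall_sub_one_le hq hd hN hK hS (T := (N : ℝ) ^ q - m) (by simp)
    have hK0 : 0 ≤ 2 * dens q d N := mul_nonneg zero_le_two dens_nonneg
    rw [pow_succ', mul_assoc]
    push_cast
    rw [← sub_sub]
    exact this.trans (mul_le_mul_of_nonneg_left ih hK0)

/-- Few points of the ball satisfy the constraint with one unit to spare. -/
lemma card_qsum_le_sub_one (hd : 1 ≤ d) (hN : 1 ≤ N) (hK : dens q d N ≤ 1 / 1000) :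
    (((ballFinset hq d N).filter fun x => qsum q x ≤ (N : ℝ) ^ q - 1).card : ℝ)
      ≤ 2 * dens q d N * (ballFinset hq d N).card := by
  have := card_subBall_sub_nat_le hq hd hN hK (S := ∅) (by simp) 1
  simpa [subBall] using this

/-- The probability that a coordinate equals `j` is at most `(2κ^q)^⌊|j|^q⌋`. -/
lemma card_coord_eq_le (hd : 1 ≤ d) (hN : 1 ≤ N) (hK : dens q d N ≤ 1 / 1000) (i : Fin d) (j : ℤ) :
    (((ballFinset hq d N).filter fun x => x i = j).card : ℝ)
      ≤ (2 * dens q d N) ^ ⌊|(j : ℝ)| ^ q⌋₊ * (ballFinset hq d N).card := by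
  have hq0 : q ≠ 0 := by linarith
  refine le_trans ?_ (card_subBall_sub_nat_le hq hd hN hK (S := {i}) (by simp) _)
  have hfl : (⌊|(j : ℝ)| ^ q⌋₊ : ℝ) ≤ |(j : ℝ)| ^ q := Nat.floor_le (by positivity)
  -- Erasing coordinate `i` is injective once its value is fixed, and frees `|j|^q` units of radius;
  -- the choice `S = {i}` keeps that coordinate zero.
  refine Nat.cast_le.2 (card_le_card_of_injOn (fun x => Function.update x i 0) ?_ ?_)
  · intro x hx
    have hx' : x ∈ ballFinset hq d N ∧ x i = j := by simpa using hx
    rw [mem_ballFinset] at hx'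
    rw [mem_coe, mem_subBall hq (by simp), qsum_update, hx'.2]
    refine ⟨by simp, ?_⟩
    simp only [Int.cast_zero, abs_zero, Real.zero_rpow hq0]
    linarith [hx'.1]
  · intro x hx y hy hxy
    have hx' : x i = j := by
      have : x ∈ ballFinset hq d N ∧ x i = j := by simpa using hx
      exact this.2
    have hy' : y i = j := by
      have : y ∈ ballFinset hq d N ∧ y i = j := by simpa using hy
      exact this.2
    funext k
    by_cases hk : k = i
    · rw [hk, hx', hy']
    · simpa [Function.update_of_ne hk] using congrFun hxy k

lemma card_coord_natAbs_eq_le (hd : 1 ≤ d) (hN : 1 ≤ N) (hK : dens q d N ≤ 1 / 1000) (i : Fin d)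
    (j : ℕ) :
    (((ballFinset hq d N).filter fun x => (x i).natAbs = j).card : ℝ)
      ≤ 2 * (2 * dens q d N) ^ ⌊(j : ℝ) ^ q⌋₊ * (ballFinset hq d N).card := by
  have h1 := card_coord_eq_le hq hd hN hK i j
  have h2 := card_coord_eq_le hq hd hN hK i (-j)
  simp only [Int.cast_neg, Int.cast_natCast, abs_neg, Nat.abs_cast] at h1 h2
  have h3 : ((ballFinset hq d N).filter fun x => (x i).natAbs = j).card ≤
      ((ballFinset hq d N).filter fun x => x i = (j : ℤ)).card +
      ((ballFinset hq d N).filter fun x => x i = -(j : ℤ)).card := by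
    refine le_trans (card_le_card ?_) (card_union_le _ _)
    intro x hx
    simp only [mem_filter, mem_union] at hx ⊢
    have := Int.natAbs_eq (x i)
    rw [hx.2] at this
    tauto
  have h3' : (((ballFinset hq d N).filter fun x => (x i).natAbs = j).card : ℝ) ≤
      ((ballFinset hq d N).filter fun x => x i = (j : ℤ)).card +
      ((ballFinset hq d N).filter fun x => x i = -(j : ℤ)).card := by exact_mod_cast h3
  linarith

lemma le_floor_rpow {q : ℝ} (hq : 1 ≤ q) (j : ℕ) : j ≤ ⌊(j : ℝ) ^ q⌋₊ := by
  rcases Nat.eq_zero_or_pos j with rfl | hj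
  · simp
  · exact Nat.le_floor (Real.self_le_rpow_of_one_le (by exact_mod_cast hj) hq)

/-- Tail moments of a coordinate for weights of at most exponential growth. -/
lemma sum_coord_weight_le (hd : 1 ≤ d) (hN : 1 ≤ N) (hK : dens q d N ≤ 1 / 1000) (i : Fin d)
    {h : ℕ → ℝ} (h0 : ∀ j, 0 ≤ h j) (h4 : ∀ j : ℕ, h j ≤ 4 ^ ⌊(j : ℝ) ^ q⌋₊) (a : ℕ) :
    ∑ x ∈ (ballFinset hq d N).filter (fun x => a ≤ (x i).natAbs), h (x i).natAbs
      ≤ 4 * (8 * dens q d N) ^ a * (ballFinset hq d N).card := by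
  classical
  set B := ballFinset hq d N with hB
  set K := dens q d N with hKdef
  have hK0 : 0 ≤ K := dens_nonneg
  set s := B.filter (fun x => a ≤ (x i).natAbs) with hs
  set J := s.image fun x => (x i).natAbs with hJ
  -- The ratio is `2K` from the probability of each value times `4` from the weight; the geometric
  -- tail costs a further factor `2`, as do the two signs.
  set r := 8 * K with hr
  have hr0 : 0 ≤ r := by positivity
  have hr1 : r ≤ 1 / 2 := by rw [hr]; linarith
  rw [← sum_fiberwise_of_maps_to (t := J) (g := fun x : Fin d → ℤ => (x i).natAbs)
    (fun x hx => mem_image_of_mem _ hx)]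
  have hterm : ∀ j ∈ J, ∑ x ∈ s.filter (fun x => (x i).natAbs = j), h (x i).natAbs
      ≤ 2 * B.card * r ^ j := by
    intro j _
    have e1 : ∑ x ∈ s.filter (fun x => (x i).natAbs = j), h (x i).natAbs
        = ((s.filter fun x => (x i).natAbs = j).card : ℝ) * h j := by
      rw [← nsmul_eq_mul, ← sum_const]
      exact sum_congr rfl fun x hx => by rw [(mem_filter.1 hx).2]
    have e2 : ((s.filter fun x => (x i).natAbs = j).card : ℝ) ≤
        2 * (2 * K) ^ ⌊(j : ℝ) ^ q⌋₊ * B.card := by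
      refine le_trans ?_ (card_coord_natAbs_eq_le hq hd hN hK i j)
      exact_mod_cast card_le_card (filter_subset_filter _ (filter_subset _ _))
    rw [e1]
    calc ((s.filter fun x => (x i).natAbs = j).card : ℝ) * h j
        ≤ (2 * (2 * K) ^ ⌊(j : ℝ) ^ q⌋₊ * B.card) * 4 ^ ⌊(j : ℝ) ^ q⌋₊ :=
          mul_le_mul e2 (h4 j) (h0 j) (by positivity)
      _ = 2 * B.card * r ^ ⌊(j : ℝ) ^ q⌋₊ := by
          rw [show r = (2 * K) * 4 by rw [hr]; ring, mul_pow (2 * K) 4]; ring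
      _ ≤ 2 * B.card * r ^ j :=
          mul_le_mul_of_nonneg_left (pow_le_pow_of_le_one hr0 (by linarith) (le_floor_rpow hq j))
            (by positivity)
  refine (sum_le_sum hterm).trans ?_
  rw [← mul_sum]
  obtain ⟨M, hM⟩ := J.exists_nat_subset_range
  have hgeom : ∑ j ∈ J, r ^ j ≤ r ^ a / (1 - r) := by
    refine le_trans (sum_le_sum_of_subset_of_nonneg (t := Ico a M) ?_ fun _ _ _ => by positivity)
      (geom_sum_Ico_le_of_lt_one hr0 (by linarith))
    intro j hj
    refine mem_Ico.2 ⟨?_, mem_range.1 (hM hj)⟩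
    obtain ⟨x, hx, rfl⟩ := mem_image.1 hj
    exact (mem_filter.1 hx).2
  have h2 : r ^ a / (1 - r) ≤ 2 * r ^ a := by
    rw [div_le_iff₀ (by linarith)]
    nlinarith [pow_nonneg hr0 a]
  calc 2 * (B.card : ℝ) * ∑ j ∈ J, r ^ j ≤ 2 * B.card * (2 * r ^ a) :=
        mul_le_mul_of_nonneg_left (hgeom.trans h2) (by positivity)
    _ = 4 * r ^ a * B.card := by ring

lemma sum_coord_sq_le (hd : 1 ≤ d) (hN : 1 ≤ N) (hK : dens q d N ≤ 1 / 1000) (i : Fin d) :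
    ∑ x ∈ ballFinset hq d N, (x i : ℝ) ^ 2 ≤ 32 * dens q d N * (ballFinset hq d N).card := by
  have h := sum_coord_weight_le hq hd hN hK i (h := fun j => (j : ℝ) ^ 2)
    (fun j => by positivity) (fun j => ?_) 1
  · refine le_trans (le_of_eq ?_) (h.trans (le_of_eq (by ring)))
    rw [sum_filter]
    refine sum_congr rfl fun x _ => ?_
    rw [Nat.cast_natAbs, Int.cast_abs, sq_abs]
    split_ifs with hx
    · rfl
    · have : x i = 0 := by omega
      simp [this]
  · have h1 : (j : ℝ) ≤ 2 ^ ⌊(j : ℝ) ^ q⌋₊ := by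
      exact_mod_cast (le_floor_rpow hq j).trans Nat.lt_two_pow_self.le
    calc (j : ℝ) ^ 2 ≤ (2 ^ ⌊(j : ℝ) ^ q⌋₊) ^ 2 := by gcongr
      _ = 4 ^ ⌊(j : ℝ) ^ q⌋₊ := by rw [← pow_mul, mul_comm, pow_mul]; norm_num

/-- Starting at absolute value `2` gains a second factor `K`. Summed over `d` coordinates this gives
`O(K N^q)`, negligible against `N^q`. -/
lemma sum_coord_tail_le (hd : 1 ≤ d) (hN : 1 ≤ N) (hK : dens q d N ≤ 1 / 1000) (i : Fin d) :
    ∑ x ∈ ballFinset hq d N, (if 2 ≤ (x i).natAbs then |(x i : ℝ)| ^ q else 0)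
      ≤ 256 * dens q d N ^ 2 * (ballFinset hq d N).card := by
  have h := sum_coord_weight_le hq hd hN hK i (h := fun j => (j : ℝ) ^ q)
    (fun j => by positivity) (fun j => ?_) 2
  · refine le_trans (le_of_eq ?_) (h.trans (le_of_eq (by ring)))
    rw [sum_filter]
    refine sum_congr rfl fun x _ => ?_
    rw [Nat.cast_natAbs, Int.cast_abs]
  · have h1 : (⌊(j : ℝ) ^ q⌋₊ : ℝ) + 1 ≤ 4 ^ ⌊(j : ℝ) ^ q⌋₊ := by
      exact_mod_cast Nat.lt_pow_self (by norm_num)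
    exact (Nat.lt_floor_add_one _).le.trans h1

/-- The set of coordinates of absolute value one. -/
def ones {d : ℕ} (x : Fin d → ℤ) : Finset (Fin d) := univ.filter fun i => (x i).natAbs = 1

lemma qsum_eq_card_ones_add {q : ℝ} (hq : 1 ≤ q) {d : ℕ} (x : Fin d → ℤ) :
    qsum q x = (ones x).card + ∑ i, (if 2 ≤ (x i).natAbs then |(x i : ℝ)| ^ q else 0) := by
  have hq0 : q ≠ 0 := by linarith
  rw [ones, card_eq_sum_ones, Nat.cast_sum, sum_filter, ← sum_add_distrib, qsum]
  refine sum_congr rfl fun i _ => ?_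
  have habs : |(x i : ℝ)| = ((x i).natAbs : ℝ) := by rw [Nat.cast_natAbs, Int.cast_abs]
  rw [habs]
  rcases lt_trichotomy (x i).natAbs 1 with h | h | h
  · have : (x i).natAbs = 0 := by omega
    simp [this, Real.zero_rpow hq0]
  · simp [h]
  · have h1 : (x i).natAbs ≠ 1 := by omega
    have h2 : 2 ≤ (x i).natAbs := h
    simp [h1, h2]

/-- All but a small proportion of the points of the ball have at least `N^q / 2` coordinates
of absolute value one. -/
lemma card_few_ones_le (hd : 1 ≤ d) (hN : 1 ≤ N) (hK : dens q d N ≤ 1 / 1000)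
    (h4 : 4 ≤ (N : ℝ) ^ q) :
    (((ballFinset hq d N).filter fun x => ((ones x).card : ℝ) < (N : ℝ) ^ q / 2).card : ℝ)
      ≤ 1026 * dens q d N * (ballFinset hq d N).card := by
  classical
  set B := ballFinset hq d N with hB
  set n := (N : ℝ) ^ q with hn
  set tail : (Fin d → ℤ) → ℝ := fun x =>
    ∑ i, (if 2 ≤ (x i).natAbs then |(x i : ℝ)| ^ q else 0) with htail
  have htail0 : ∀ x, 0 ≤ tail x := fun x =>
    sum_nonneg fun i _ => by split_ifs <;> positivity
  -- Outside both exceptional sets there are more than `n - 1 - n/4` unit coordinates, which is at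
  -- least `n/2` because `n ≥ 4`.
  have hsub : (B.filter fun x => ((ones x).card : ℝ) < n / 2) ⊆
      (B.filter fun x => qsum q x ≤ n - 1) ∪ B.filter fun x => n / 4 ≤ tail x := by
    intro x hx
    simp only [mem_filter, mem_union] at hx ⊢
    by_contra hcon
    push Not at hcon
    have h1 := hcon.1 hx.1
    have h2 := hcon.2 hx.1
    have h3 := qsum_eq_card_ones_add hq x
    have h5 : tail x < n / 4 := h2
    simp only [htail] at h5
    linarith [hx.2]
  have hcard : ((B.filter fun x => ((ones x).card : ℝ) < n / 2).card : ℝ) ≤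
      (B.filter fun x => qsum q x ≤ n - 1).card + (B.filter fun x => n / 4 ≤ tail x).card := by
    exact_mod_cast (card_le_card hsub).trans (card_union_le _ _)
  have hd0 : (0 : ℝ) < d := by exact_mod_cast hd
  have hmean : ∑ x ∈ B, tail x ≤ n * (256 * dens q d N * B.card) := by
    rw [htail, sum_comm]
    calc _ ≤ ∑ _i : Fin d, 256 * dens q d N ^ 2 * (B.card : ℝ) :=
          sum_le_sum fun i _ => sum_coord_tail_le hq hd hN hK i
      _ = d * (256 * dens q d N ^ 2 * B.card) := by simp
      _ = (dens q d N * d) * (256 * dens q d N * B.card) := by ring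
      _ = _ := by rw [dens, div_mul_cancel₀ _ hd0.ne']
  have hmarkov : n / 4 * (B.filter fun x => n / 4 ≤ tail x).card ≤ ∑ x ∈ B, tail x := by
    calc n / 4 * ((B.filter fun x => n / 4 ≤ tail x).card : ℝ)
        = ∑ x ∈ B.filter (fun x => n / 4 ≤ tail x), n / 4 := by
          rw [sum_const, nsmul_eq_mul, mul_comm]
      _ ≤ ∑ x ∈ B.filter (fun x => n / 4 ≤ tail x), tail x :=
          sum_le_sum fun x hx => (mem_filter.1 hx).2
      _ ≤ _ := sum_le_sum_of_subset_of_nonneg (filter_subset _ _) fun x _ _ => htail0 x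
  have h6 : ((B.filter fun x => n / 4 ≤ tail x).card : ℝ) ≤ 1024 * dens q d N * B.card := by
    have hn0 : 0 < n := by linarith
    have := hmarkov.trans hmean
    refine le_of_mul_le_mul_left ?_ hn0
    linarith
  have h7 := card_qsum_le_sub_one hq hd hN hK
  linarith

end Counting

end LqBall

end

/-! ### Averages over random permutations. -/

noncomputable section

namespace LqBall

open Finset

section Permutations

open Equiv

/-- Averaging over permutations a function of the images of `k` distinct points amounts to averaging
over all injective `k`-tuples. -/
lemma card_embedding_mul_sum_perm {α : Type*} [Fintype α] [DecidableEq α] {k : ℕ}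
    (f : (Fin k → α) → ℝ) (ι : Fin k ↪ α) :
    (Fintype.card (Fin k ↪ α) : ℝ) * ∑ σ : Perm α, f (fun l => σ (ι l))
      = Fintype.card (Perm α) * ∑ ι' : Fin k ↪ α, f ι' := by
  have hindep : ∀ ι' : Fin k ↪ α,
      ∑ σ : Perm α, f (fun l => σ (ι' l)) = ∑ σ : Perm α, f (fun l => σ (ι l)) := by
    intro ι'
    obtain ⟨τ, rfl⟩ := Equiv.Perm.exists_smul_eq_embedding ι ι'
    exact Fintype.sum_equiv (Equiv.mulRight τ) _ _ fun σ => by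
      simp [Function.Embedding.smul_apply]
  have hinv : ∀ σ : Perm α,
      ∑ ι' : Fin k ↪ α, f (fun l => σ (ι' l)) = ∑ ι' : Fin k ↪ α, f ι' := by
    intro σ
    refine Fintype.sum_equiv (Equiv.embeddingCongr (Equiv.refl _) σ) _ _ fun ι' => ?_
    congr 1
  calc (Fintype.card (Fin k ↪ α) : ℝ) * ∑ σ : Perm α, f (fun l => σ (ι l))
      = ∑ ι' : Fin k ↪ α, ∑ σ : Perm α, f (fun l => σ (ι' l)) := by
        rw [sum_congr rfl fun ι' _ => hindep ι', sum_const, card_univ, nsmul_eq_mul]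
    _ = ∑ σ : Perm α, ∑ ι' : Fin k ↪ α, f (fun l => σ (ι' l)) := sum_comm
    _ = _ := by
        rw [sum_congr rfl fun σ _ => hinv σ, sum_const, card_univ, nsmul_eq_mul]

variable {d : ℕ}

/-- The sum of `w` over ordered pairs of distinct indices. -/
def pairSum (w : Fin d → Fin d → ℝ) : ℝ := ∑ ι : Fin 2 ↪ Fin d, w (ι 0) (ι 1)

lemma pairSum_eq (w : Fin d → Fin d → ℝ) :
    pairSum w = ∑ u, ∑ v, w u v - ∑ u, w u u := by
  have h1 : pairSum w = ∑ p ∈ (univ : Finset (Fin d)).offDiag, w p.1 p.2 := by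
    refine sum_bij' (fun ι _ => (ι 0, ι 1))
      (fun p hp => ⟨![p.1, p.2], ?_⟩) ?_ ?_ ?_ ?_ ?_
    · have hne : p.1 ≠ p.2 := by simpa using hp
      intro a b hab
      fin_cases a <;> fin_cases b <;> simp_all
    · intro ι _
      simp
    · intros; exact mem_univ _
    · intro ι _
      ext l
      fin_cases l <;> rfl
    · intro p _; rfl
    · intro ι _; rfl
  have h2 : ∑ p ∈ (univ : Finset (Fin d)) ×ˢ univ, w p.1 p.2
      = ∑ p ∈ (univ : Finset (Fin d)).diag, w p.1 p.2
        + ∑ p ∈ (univ : Finset (Fin d)).offDiag, w p.1 p.2 := by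
    rw [← diag_union_offDiag, sum_union (disjoint_diag_offDiag _)]
  rw [sum_product, sum_diag] at h2
  rw [h1, h2]; ring

lemma sum_perm_pair (hd : 20 ≤ d) (w : Fin d → Fin d → ℝ) {i j : Fin d} (hij : i ≠ j) :
    ∑ σ : Perm (Fin d), w (σ i) (σ j)
      = Fintype.card (Perm (Fin d)) * (pairSum w / (d * (d - 1))) := by
  have hinj : Function.Injective ![i, j] := by
    intro a b hab
    fin_cases a <;> fin_cases b <;> simp_all
  have h := card_embedding_mul_sum_perm (fun t : Fin 2 → Fin d => w (t 0) (t 1)) ⟨![i, j], hinj⟩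
  have hd' : (20 : ℝ) ≤ d := by exact_mod_cast hd
  have hcard : (Fintype.card (Fin 2 ↪ Fin d) : ℝ) = d * (d - 1) := by
    rw [Fintype.card_embedding_eq, Fintype.card_fin, Fintype.card_fin, Nat.cast_descFactorial_two]
  rw [hcard] at h
  have hne : (d : ℝ) * (d - 1) ≠ 0 := by
    apply mul_ne_zero <;> linarith
  rw [mul_div_assoc', eq_div_iff hne, mul_comm]
  exact h

/-- Near independence of disjoint pairs: injective quadruples embed into pairs of injective pairs,
and `w ≥ 0`. The factor `1 + 8/d` absorbs the ratio of `d(d-1)` to `(d-2)(d-3)`. -/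
lemma sum_perm_pair_mul_le (hd : 20 ≤ d) {w : Fin d → Fin d → ℝ} (w0 : ∀ u v, 0 ≤ w u v)
    {i j k l : Fin d} (hinj : Function.Injective ![i, j, k, l]) :
    ∑ σ : Perm (Fin d), w (σ i) (σ j) * w (σ k) (σ l)
      ≤ Fintype.card (Perm (Fin d)) * ((pairSum w / (d * (d - 1))) ^ 2 * (1 + 8 / d)) := by
  have h := card_embedding_mul_sum_perm
    (fun t : Fin 4 → Fin d => w (t 0) (t 1) * w (t 2) (t 3)) ⟨![i, j, k, l], hinj⟩
  have hd' : (20 : ℝ) ≤ d := by exact_mod_cast hd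
  have hcard : (Fintype.card (Fin 4 ↪ Fin d) : ℝ) = d * (d - 1) * ((d - 2) * (d - 3)) := by
    rw [Fintype.card_embedding_eq, Fintype.card_fin, Fintype.card_fin]
    simp only [Nat.descFactorial_succ, Nat.descFactorial_zero]
    push_cast [Nat.cast_sub (by omega : 3 ≤ d), Nat.cast_sub (by omega : 2 ≤ d),
      Nat.cast_sub (by omega : 1 ≤ d)]
    simp; ring
  have hle : ∑ ι : Fin 4 ↪ Fin d, w (ι 0) (ι 1) * w (ι 2) (ι 3) ≤ pairSum w ^ 2 := by
    rw [sq, pairSum, sum_mul_sum, ← sum_product']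
    let F : (Fin 4 ↪ Fin d) → (Fin 2 ↪ Fin d) × (Fin 2 ↪ Fin d) := fun ι =>
      (⟨fun a => ι (Fin.castAdd 2 a), ι.injective.comp (Fin.castAdd_injective 2 2)⟩,
       ⟨fun a => ι (Fin.natAdd 2 a), ι.injective.comp (Fin.natAdd_injective 2 2)⟩)
    have hF : Function.Injective F := by
      intro ι ι' hh
      have e1 := fun a => DFunLike.congr_fun (congrArg Prod.fst hh) a
      have e2 := fun a => DFunLike.congr_fun (congrArg Prod.snd hh) a
      ext a
      refine congrArg Fin.val ?_
      refine Fin.addCases (m := 2) (n := 2) (motive := fun a => ι a = ι' a) ?_ ?_ a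
      · exact e1
      · exact e2
    calc ∑ ι : Fin 4 ↪ Fin d, w (ι 0) (ι 1) * w (ι 2) (ι 3)
        = ∑ ι : Fin 4 ↪ Fin d, w ((F ι).1 0) ((F ι).1 1) * w ((F ι).2 0) ((F ι).2 1) := rfl
      _ = ∑ p ∈ univ.map ⟨F, hF⟩, w (p.1 0) (p.1 1) * w (p.2 0) (p.2 1) := by
          rw [sum_map]; rfl
      _ ≤ _ := sum_le_sum_of_subset_of_nonneg (fun _ _ => by simp)
          fun _ _ _ => mul_nonneg (w0 _ _) (w0 _ _)
  rw [hcard] at h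
  have hp : (0 : ℝ) ≤ Fintype.card (Perm (Fin d)) := by positivity
  have h2 := h.le.trans (mul_le_mul_of_nonneg_left hle hp)
  set p : ℝ := (Fintype.card (Perm (Fin d)) : ℝ)
  set s := ∑ σ : Perm (Fin d), w (σ i) (σ j) * w (σ k) (σ l)
  have h3 : (d : ℝ) * (d - 1) * ((d - 2) * (d - 3)) * s ≤ p * pairSum w ^ 2 := h2
  have hA : (0 : ℝ) < d * (d - 1) := by apply mul_pos <;> linarith
  have hC : (0 : ℝ) < (d - 2) * (d - 3) := by apply mul_pos <;> linarith
  have hratio : (d : ℝ) * (d - 1) ≤ ((d - 2) * (d - 3)) * (1 + 8 / d) := by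
    have : ((d : ℝ) - 2) * (d - 3) * (1 + 8 / d) - d * (d - 1)
        = (4 * d ^ 2 - 34 * d + 48) / d := by
      have : (d : ℝ) ≠ 0 := by linarith
      field_simp; ring
    have h0 : (0 : ℝ) ≤ (4 * d ^ 2 - 34 * d + 48) / d := by
      apply div_nonneg _ (by linarith); nlinarith
    linarith
  set μ := pairSum w / (d * (d - 1)) with hμ
  have hS : pairSum w = μ * (d * (d - 1)) := (div_mul_cancel₀ _ hA.ne').symm
  rw [hS] at h3
  have h4 : ((d : ℝ) * (d - 1)) * (((d - 2) * (d - 3)) * s)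
      ≤ ((d : ℝ) * (d - 1)) * (p * μ ^ 2 * (d * (d - 1))) := by
    nlinarith [h3]
  have h5 := le_of_mul_le_mul_left h4 hA
  refine le_of_mul_le_mul_left (h5.trans ?_) hC
  calc p * μ ^ 2 * (d * (d - 1)) ≤ p * μ ^ 2 * (((d - 2) * (d - 3)) * (1 + 8 / d)) :=
        mul_le_mul_of_nonneg_left hratio (by positivity)
    _ = _ := by ring

/-- Second moment estimate for sums over disjoint pairs in a random permutation. -/
lemma sum_perm_sq_sub_le (hd : 20 ≤ d) {w : Fin d → Fin d → ℝ} (w0 : ∀ u v, 0 ≤ w u v)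
    (w1 : ∀ u v, w u v ≤ 1) {I : Finset (Fin d)} {φ : Fin d → Fin d} (hφ : Set.InjOn φ I)
    (hI : ∀ i ∈ I, φ i ∉ I) {m : ℝ} (hm : m = I.card * (pairSum w / (d * (d - 1)))) :
    ∑ σ : Perm (Fin d), (∑ i ∈ I, w (σ i) (σ (φ i)) - m) ^ 2
      ≤ Fintype.card (Perm (Fin d)) * (m + 8 * m ^ 2 / d) := by
  set p : ℝ := (Fintype.card (Perm (Fin d)) : ℝ) with hp
  set μ := pairSum w / (d * (d - 1)) with hμ
  have hp0 : 0 ≤ p := by positivity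
  have hne : ∀ i ∈ I, i ≠ φ i := fun i hi h => hI i hi (h ▸ hi)
  have hfirst : ∑ σ : Perm (Fin d), ∑ i ∈ I, w (σ i) (σ (φ i)) = p * m := by
    rw [sum_comm, sum_congr rfl fun i hi => sum_perm_pair hd w (hne i hi), sum_const, nsmul_eq_mul, hm]
    ring
  -- On the diagonal `w² ≤ w`; off it the four indices are distinct, because `φ` is injective on `I`
  -- and leaves `I`.
  have hterm : ∀ i ∈ I, ∀ j ∈ I, ∑ σ : Perm (Fin d), w (σ i) (σ (φ i)) * w (σ j) (σ (φ j))
      ≤ p * (μ ^ 2 * (1 + 8 / d)) + if i = j then p * μ else 0 := by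
    intro i hi j hj
    have hpos : 0 ≤ p * (μ ^ 2 * (1 + 8 / d)) := by positivity
    split_ifs with hij
    · subst hij
      have : ∑ σ : Perm (Fin d), w (σ i) (σ (φ i)) * w (σ i) (σ (φ i)) ≤ p * μ := by
        rw [← sum_perm_pair hd w (hne i hi)]
        exact sum_le_sum fun σ _ => mul_le_of_le_one_left (w0 _ _) (w1 _ _)
      linarith
    · rw [add_zero]
      refine sum_perm_pair_mul_le hd w0 ?_
      have e1 := hne i hi
      have e2 := hne j hj
      have e3 : φ i ≠ φ j := fun h => hij (hφ hi hj h)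
      have e4 : φ i ≠ j := fun h => hI i hi (h ▸ hj)
      have e5 : φ j ≠ i := fun h => hI j hj (h ▸ hi)
      intro a b hab
      fin_cases a <;> fin_cases b <;> simp_all [eq_comm]
  have hsecond : ∑ σ : Perm (Fin d), (∑ i ∈ I, w (σ i) (σ (φ i))) ^ 2
      ≤ p * (m ^ 2 * (1 + 8 / d) + m) := by
    calc ∑ σ : Perm (Fin d), (∑ i ∈ I, w (σ i) (σ (φ i))) ^ 2
        = ∑ i ∈ I, ∑ j ∈ I, ∑ σ : Perm (Fin d), w (σ i) (σ (φ i)) * w (σ j) (σ (φ j)) := by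
          simp only [sq, sum_mul_sum]
          rw [sum_comm]
          exact sum_congr rfl fun i _ => sum_comm
      _ ≤ ∑ i ∈ I, ∑ j ∈ I, (p * (μ ^ 2 * (1 + 8 / d)) + if i = j then p * μ else 0) :=
          sum_le_sum fun i hi => sum_le_sum fun j hj => hterm i hi j hj
      _ = I.card * (I.card * (p * (μ ^ 2 * (1 + 8 / d)))) + I.card * (p * μ) := by
          simp only [sum_add_distrib, sum_const, nsmul_eq_mul, sum_ite_eq]
          rw [sum_ite_mem, inter_self, sum_const, nsmul_eq_mul]
      _ = _ := by rw [hm]; ring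
  have hexpand : ∑ σ : Perm (Fin d), (∑ i ∈ I, w (σ i) (σ (φ i)) - m) ^ 2
      = ∑ σ : Perm (Fin d), (∑ i ∈ I, w (σ i) (σ (φ i))) ^ 2
        - 2 * m * ∑ σ : Perm (Fin d), ∑ i ∈ I, w (σ i) (σ (φ i)) + p * m ^ 2 := by
    rw [mul_sum, ← sum_sub_distrib, hp, ← nsmul_eq_mul, ← card_univ, ← sum_const, ← sum_add_distrib]
    exact sum_congr rfl fun σ _ => by ring
  rw [hexpand, hfirst]
  have : p * (m + 8 * m ^ 2 / d) = p * (m ^ 2 * (1 + 8 / d) + m) - 2 * m * (p * m) + p * m ^ 2 := by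
    ring
  rw [this]
  linarith

lemma exp_neg_le_inv {x : ℝ} (hx : 0 < x) : Real.exp (-x) ≤ x⁻¹ := by
  rw [Real.exp_neg]
  exact inv_anti₀ hx (by linarith [Real.add_one_le_exp x])

/-- A pointwise form of Chebyshev: either `W ≥ m/2` and the exponential is small, or the quadratic
term is at least `1`. -/
lemma exp_neg_le_add_sq {m W : ℝ} (hm : 0 < m) (hW : 0 ≤ W) :
    Real.exp (-W) ≤ 2 / m + 4 / m ^ 2 * (W - m) ^ 2 := by
  rcases le_total (m / 2) W with h | h
  · have h1 : Real.exp (-W) ≤ 2 / m := by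
      calc Real.exp (-W) ≤ Real.exp (-(m / 2)) := Real.exp_le_exp.2 (by linarith)
        _ ≤ (m / 2)⁻¹ := exp_neg_le_inv (by linarith)
        _ = 2 / m := by rw [inv_div]
    have : 0 ≤ 4 / m ^ 2 * (W - m) ^ 2 := by positivity
    linarith
  · have h1 : Real.exp (-W) ≤ 1 := Real.exp_le_one_iff.2 (by linarith)
    have h2 : 1 ≤ 4 / m ^ 2 * (W - m) ^ 2 := by
      rw [div_mul_eq_mul_div, le_div_iff₀ (by positivity)]
      nlinarith
    have : 0 ≤ 2 / m := by positivity
    linarith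

lemma sum_perm_exp_neg_le (hd : 20 ≤ d) {w : Fin d → Fin d → ℝ} (w0 : ∀ u v, 0 ≤ w u v)
    (w1 : ∀ u v, w u v ≤ 1) {I : Finset (Fin d)} {φ : Fin d → Fin d} (hφ : Set.InjOn φ I)
    (hI : ∀ i ∈ I, φ i ∉ I) {m : ℝ} (hm : m = I.card * (pairSum w / (d * (d - 1))))
    (hm0 : 0 < m) :
    ∑ σ : Perm (Fin d), Real.exp (-∑ i ∈ I, w (σ i) (σ (φ i)))
      ≤ Fintype.card (Perm (Fin d)) * (6 / m + 32 / d) := by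
  have h := sum_perm_sq_sub_le hd w0 w1 hφ hI hm
  have hdp : (0 : ℝ) < d := by exact_mod_cast (by omega : 0 < d)
  calc ∑ σ : Perm (Fin d), Real.exp (-∑ i ∈ I, w (σ i) (σ (φ i)))
      ≤ ∑ σ : Perm (Fin d), (2 / m + 4 / m ^ 2 * (∑ i ∈ I, w (σ i) (σ (φ i)) - m) ^ 2) :=
        sum_le_sum fun σ _ => exp_neg_le_add_sq hm0 (sum_nonneg fun _ _ => w0 _ _)
    _ = Fintype.card (Perm (Fin d)) * (2 / m)
        + 4 / m ^ 2 * ∑ σ : Perm (Fin d), (∑ i ∈ I, w (σ i) (σ (φ i)) - m) ^ 2 := by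
        rw [sum_add_distrib, sum_const, card_univ, nsmul_eq_mul, mul_sum]
    _ ≤ Fintype.card (Perm (Fin d)) * (2 / m)
        + 4 / m ^ 2 * (Fintype.card (Perm (Fin d)) * (m + 8 * m ^ 2 / d)) := by gcongr
    _ = _ := by field_simp; ring

/-- Symmetrizing a permutation average over the transpositions `(i, φ i)`, `i ∈ J`. -/
lemma sum_perm_prod_eq {f : Fin d → Fin d → ℝ} {a : Fin d → ℝ} {φ : Fin d → Fin d}
    (J : Finset (Fin d)) (hφ : Set.InjOn φ J) (hJ : ∀ i ∈ J, ∀ j ∈ J, φ i ≠ j)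
    (hfa : ∀ i ∈ J, ∀ u, f i u = a u) (hf1 : ∀ i ∈ J, ∀ u, f (φ i) u = 1) :
    ∑ σ : Perm (Fin d), ∏ i, f i (σ i)
      = ∑ σ : Perm (Fin d), (∏ i ∈ J, (a (σ i) + a (σ (φ i))) / 2) * ∏ i ∈ Jᶜ, f i (σ i) := by
  induction J using Finset.induction_on with
  | empty => simp
  | insert i₀ J hi₀ ih =>
    have hsub : (J : Set (Fin d)) ⊆ (insert i₀ J : Finset (Fin d)) := by simp
    rw [ih (hφ.mono hsub)
      (fun i hi j hj => hJ i (mem_insert_of_mem hi) j (mem_insert_of_mem hj))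
      (fun i hi => hfa i (mem_insert_of_mem hi)) (fun i hi => hf1 i (mem_insert_of_mem hi))]
    set R : Perm (Fin d) → ℝ := fun σ =>
      (∏ i ∈ J, (a (σ i) + a (σ (φ i))) / 2) * ∏ i ∈ (insert i₀ J)ᶜ, f i (σ i) with hR
    have hmem : i₀ ∈ insert i₀ J := mem_insert_self _ _
    have hleft : ∀ σ : Perm (Fin d),
        (∏ i ∈ J, (a (σ i) + a (σ (φ i))) / 2) * ∏ i ∈ Jᶜ, f i (σ i) = R σ * a (σ i₀) := by
      intro σ
      have : Jᶜ = insert i₀ (insert i₀ J)ᶜ := by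
        ext k; by_cases hk : k = i₀ <;> simp [hk, hi₀]
      rw [this, prod_insert (by simp), hfa i₀ hmem, hR]
      ring
    have hright : ∀ σ : Perm (Fin d),
        (∏ i ∈ insert i₀ J, (a (σ i) + a (σ (φ i))) / 2) * ∏ i ∈ (insert i₀ J)ᶜ, f i (σ i)
          = (R σ * a (σ i₀) + R σ * a (σ (φ i₀))) / 2 := by
      intro σ
      rw [prod_insert hi₀, hR]
      ring
    -- `R` does not involve `σ i₀`, and it meets `σ (φ i₀)` only through a factor identically `1`.
    have hinv : ∀ σ : Perm (Fin d), R (σ * swap i₀ (φ i₀)) = R σ := by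
      intro σ
      simp only [hR, Perm.mul_apply]
      congr 1
      · refine prod_congr rfl fun i hi => ?_
        have hi' := mem_insert_of_mem (b := i₀) hi
        have e1 : i ≠ i₀ := fun h => hi₀ (h ▸ hi)
        have e2 : i ≠ φ i₀ := fun h => hJ i₀ hmem i hi' h.symm
        have e3 : φ i ≠ i₀ := hJ i hi' i₀ hmem
        have e4 : φ i ≠ φ i₀ := fun h => e1 (hφ hi' hmem h)
        rw [swap_apply_of_ne_of_ne e1 e2, swap_apply_of_ne_of_ne e3 e4]
      · refine prod_congr rfl fun i hi => ?_
        have e1 : i ≠ i₀ := fun h => by simp [h] at hi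
        by_cases e2 : i = φ i₀
        · rw [e2, hf1 i₀ hmem, hf1 i₀ hmem]
        · rw [swap_apply_of_ne_of_ne e1 e2]
    have hswap : ∑ σ : Perm (Fin d), R σ * a (σ i₀) = ∑ σ : Perm (Fin d), R σ * a (σ (φ i₀)) :=
      Fintype.sum_equiv (Equiv.mulRight (swap i₀ (φ i₀))) _ _ fun σ => by
        simp [hinv]
    rw [sum_congr rfl fun σ _ => hleft σ, sum_congr rfl fun σ _ => hright σ, ← sum_div,
      sum_add_distrib, ← hswap]
    ring

/-- Expanding `(a + b ∓ 2)² ≥ 0` with `a², b² ≤ 1` gives `|a + b| / 2 ≤ 1 - (1 - a b) / 4`. -/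
lemma abs_add_div_two_le {a b : ℝ} (ha : |a| ≤ 1) (hb : |b| ≤ 1) :
    |(a + b) / 2| ≤ Real.exp (-((1 - a * b) / 4)) := by
  refine le_trans ?_ (Real.add_one_le_exp _)
  have ha2 : a ^ 2 ≤ 1 := (sq_le_one_iff_abs_le_one a).2 ha
  have hb2 : b ^ 2 ≤ 1 := (sq_le_one_iff_abs_le_one b).2 hb
  rw [abs_le]
  constructor <;> nlinarith [sq_nonneg (a + b - 2), sq_nonneg (a + b + 2)]

/-- A lower bound for the pair sum of `(1 - a_u a_v) / 4`. -/
lemma le_pairSum (hd : 20 ≤ d) {a : Fin d → ℝ} {D : ℝ}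
    (h1 : D ≤ ∑ u, (1 - a u)) (h2 : D ≤ ∑ u, (1 + a u)) (hD : 0 ≤ D) :
    d * D / 8 ≤ pairSum fun u v => (1 - a u * a v) / 4 := by
  have hd' : (20 : ℝ) ≤ d := by exact_mod_cast hd
  set A := ∑ u, a u with hA
  have e1 : ∑ u, (1 - a u) = d - A := by simp [sum_sub_distrib, hA]
  have e2 : ∑ u, (1 + a u) = d + A := by simp [sum_add_distrib, hA]
  -- This factors as `(d - |A|)(d + |A|) / 4` with `d - |A| ≥ D`. The diagonal removes at most `(d -
  -- |A|) / 2`, so `D (d - 2) / 4` remains.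
  have hfull : ∑ u, ∑ v, (1 - a u * a v) / 4 = ((d : ℝ) ^ 2 - A ^ 2) / 4 := by
    simp only [← sum_div, sum_sub_distrib, ← mul_sum, ← sum_mul]
    simp [← hA]; ring
  rw [e1] at h1
  rw [e2] at h2
  rw [pairSum_eq, hfull]
  rcases le_total 0 A with h0 | h0
  · have hdiag : ∑ u, (1 - a u * a u) / 4 ≤ ∑ u, (1 - a u) / 2 := by
      refine sum_le_sum fun u _ => ?_
      nlinarith [sq_nonneg (a u - 1)]
    rw [← sum_div _ _ (2 : ℝ), e1] at hdiag
    nlinarith [mul_nonneg (sub_nonneg.2 h1) h0, mul_nonneg (sub_nonneg.2 h1) (by linarith : (0:ℝ) ≤ d),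
      mul_nonneg hD h0]
  · have hdiag : ∑ u, (1 - a u * a u) / 4 ≤ ∑ u, (1 + a u) / 2 := by
      refine sum_le_sum fun u _ => ?_
      nlinarith [sq_nonneg (a u + 1)]
    rw [← sum_div _ _ (2 : ℝ), e2] at hdiag
    nlinarith [mul_nonneg (sub_nonneg.2 h2) (neg_nonneg.2 h0),
      mul_nonneg (sub_nonneg.2 h2) (by linarith : (0:ℝ) ≤ d), mul_nonneg hD (neg_nonneg.2 h0)]

/-- Decay of permutation averages of products with `#J` nontrivial factors. -/
lemma abs_sum_perm_prod_le (hd : 20 ≤ d) {f : Fin d → Fin d → ℝ} {a : Fin d → ℝ}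
    (ha : ∀ u, |a u| ≤ 1) (hf : ∀ i u, |f i u| ≤ 1) {φ : Fin d → Fin d}
    {J : Finset (Fin d)} (hφ : Set.InjOn φ J) (hJ : ∀ i ∈ J, φ i ∉ J)
    (hfa : ∀ i ∈ J, ∀ u, f i u = a u) (hf1 : ∀ i ∈ J, ∀ u, f (φ i) u = 1) {D g : ℝ}
    (h1 : D ≤ ∑ u, (1 - a u)) (h2 : D ≤ ∑ u, (1 + a u)) (hD : 0 < D) (hg : 0 < g)
    (hgJ : g ≤ J.card) :
    |∑ σ : Perm (Fin d), ∏ i, f i (σ i)|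
      ≤ Fintype.card (Perm (Fin d)) * (48 * d / (g * D) + 32 / d) := by
  have hd' : (20 : ℝ) ≤ d := by exact_mod_cast hd
  set w : Fin d → Fin d → ℝ := fun u v => (1 - a u * a v) / 4 with hw
  have hab : ∀ u v, |a u * a v| ≤ 1 := fun u v => by
    rw [abs_mul]; exact mul_le_one₀ (ha u) (abs_nonneg _) (ha v)
  have w0 : ∀ u v, 0 ≤ w u v := fun u v => by
    have := (abs_le.1 (hab u v)).2
    simp only [hw]; linarith
  have w1 : ∀ u v, w u v ≤ 1 := fun u v => by
    have := (abs_le.1 (hab u v)).1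
    simp only [hw]; linarith
  have hpair := le_pairSum hd h1 h2 hD.le
  set m := (J.card : ℝ) * (pairSum w / (d * (d - 1))) with hm
  have hmlow : g * D / (8 * d) ≤ m := by
    rw [hm]
    have : D / (8 * d) ≤ pairSum w / (d * (d - 1)) := by
      rw [div_le_div_iff₀ (by linarith) (by apply mul_pos <;> linarith)]
      have : (d : ℝ) * D / 8 ≤ pairSum w := hpair
      nlinarith [mul_nonneg hD.le (by linarith : (0 : ℝ) ≤ d)]
    calc g * D / (8 * d) = g * (D / (8 * d)) := by ring
      _ ≤ _ := mul_le_mul hgJ this (by positivity) (by positivity)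
  have hm0 : 0 < m := lt_of_lt_of_le (by positivity) hmlow
  rw [sum_perm_prod_eq J hφ (fun i hi j hj h => hJ i hi (h ▸ hj)) hfa hf1]
  calc |∑ σ : Perm (Fin d), (∏ i ∈ J, (a (σ i) + a (σ (φ i))) / 2) * ∏ i ∈ Jᶜ, f i (σ i)|
      ≤ ∑ σ : Perm (Fin d), |(∏ i ∈ J, (a (σ i) + a (σ (φ i))) / 2) * ∏ i ∈ Jᶜ, f i (σ i)| :=
        abs_sum_le_sum_abs _ _
    _ ≤ ∑ σ : Perm (Fin d), Real.exp (-∑ i ∈ J, w (σ i) (σ (φ i))) := by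
        refine sum_le_sum fun σ _ => ?_
        rw [abs_mul, abs_prod, abs_prod, ← sum_neg_distrib, Real.exp_sum]
        refine (mul_le_of_le_one_right (prod_nonneg fun _ _ => abs_nonneg _)
          (prod_le_one (fun _ _ => abs_nonneg _) fun i _ => hf i _)).trans ?_
        exact prod_le_prod (fun _ _ => abs_nonneg _)
          fun i _ => abs_add_div_two_le (ha _) (ha _)
    _ ≤ Fintype.card (Perm (Fin d)) * (6 / m + 32 / d) :=
        sum_perm_exp_neg_le hd w0 w1 hφ hJ hm hm0
    _ ≤ _ := by
        refine mul_le_mul_of_nonneg_left (add_le_add_left ?_ _) (by positivity)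
        calc 6 / m ≤ 6 / (g * D / (8 * d)) := by gcongr
          _ = 48 * d / (g * D) := by field_simp; norm_num

end Permutations

end LqBall

end

/-! ### Sign and permutation symmetries of the ball. -/

noncomputable section

namespace LqBall

open Finset

section Symmetrization

variable {q : ℝ} (hq : 1 ≤ q) {d N : ℕ}

lemma qsum_comp_perm (x : Fin d → ℤ) (σ : Equiv.Perm (Fin d)) : qsum q (x ∘ σ) = qsum q x :=
  Equiv.sum_comp σ fun i => |(x i : ℝ)| ^ q

lemma sum_ballFinset_comp_perm {M : Type*} [AddCommMonoid M] (F : (Fin d → ℤ) → M)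
    (σ : Equiv.Perm (Fin d)) :
    ∑ x ∈ ballFinset hq d N, F (x ∘ σ) = ∑ x ∈ ballFinset hq d N, F x := by
  refine sum_bij' (fun x _ => x ∘ σ) (fun x _ => x ∘ σ.symm) ?_ ?_ ?_ ?_ ?_
  · intro x hx
    rwa [mem_ballFinset, qsum_comp_perm, ← mem_ballFinset hq]
  · intro x hx
    rwa [mem_ballFinset, qsum_comp_perm, ← mem_ballFinset hq]
  · intro x _; funext i; simp
  · intro x _; funext i; simp
  · intro x _; rfl

lemma sum_ballFinset_neg_coord {M : Type*} [AddCommMonoid M] (F : (Fin d → ℤ) → M) (i : Fin d) :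
    ∑ x ∈ ballFinset hq d N, F (Function.update x i (-x i)) = ∑ x ∈ ballFinset hq d N, F x := by
  have hmem : ∀ x ∈ ballFinset hq d N, Function.update x i (-x i) ∈ ballFinset hq d N := by
    intro x hx
    rw [mem_ballFinset] at hx ⊢
    rw [qsum_update]
    simpa using hx
  exact sum_bij' (fun x _ => Function.update x i (-x i)) (fun x _ => Function.update x i (-x i))
    hmem hmem (fun x _ => by simp) (fun x _ => by simp) (fun x _ => rfl)

/-- Averages over the ball of products over the coordinates only see the even parts. -/
lemma sum_ballFinset_prod_even (F : Fin d → ℤ → ℂ) :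
    ∑ x ∈ ballFinset hq d N, ∏ i, F i (x i)
      = ∑ x ∈ ballFinset hq d N, ∏ i, (F i (x i) + F i (-x i)) / 2 := by
  suffices h : ∀ J : Finset (Fin d), ∑ x ∈ ballFinset hq d N, ∏ i, F i (x i)
      = ∑ x ∈ ballFinset hq d N,
        (∏ i ∈ J, (F i (x i) + F i (-x i)) / 2) * ∏ i ∈ Jᶜ, F i (x i) by
    simpa using h univ
  intro J
  induction J using Finset.induction_on with
  | empty => simp
  | insert i₀ J hi₀ ih =>
    rw [ih]
    set R : (Fin d → ℤ) → ℂ := fun x =>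
      (∏ i ∈ J, (F i (x i) + F i (-x i)) / 2) * ∏ i ∈ (insert i₀ J)ᶜ, F i (x i) with hR
    have hleft : ∀ x : Fin d → ℤ, (∏ i ∈ J, (F i (x i) + F i (-x i)) / 2) * ∏ i ∈ Jᶜ, F i (x i)
        = R x * F i₀ (x i₀) := by
      intro x
      have : Jᶜ = insert i₀ (insert i₀ J)ᶜ := by
        ext k; by_cases hk : k = i₀ <;> simp [hk, hi₀]
      rw [this, prod_insert (by simp), hR]
      ring
    have hright : ∀ x : Fin d → ℤ,
        (∏ i ∈ insert i₀ J, (F i (x i) + F i (-x i)) / 2) * ∏ i ∈ (insert i₀ J)ᶜ, F i (x i)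
          = (R x * F i₀ (x i₀) + R x * F i₀ (-x i₀)) / 2 := by
      intro x
      rw [prod_insert hi₀, hR]
      ring
    have hinv : ∀ x : Fin d → ℤ, R (Function.update x i₀ (-x i₀)) = R x := by
      intro x
      simp only [hR]
      congr 1
      · refine prod_congr rfl fun i hi => ?_
        rw [Function.update_of_ne (by rintro rfl; exact hi₀ hi)]
      · refine prod_congr rfl fun i hi => ?_
        rw [Function.update_of_ne (by rintro rfl; simp at hi)]
    have hswap : ∑ x ∈ ballFinset hq d N, R x * F i₀ (-x i₀)
        = ∑ x ∈ ballFinset hq d N, R x * F i₀ (x i₀) := by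
      rw [← sum_ballFinset_neg_coord hq (fun x => R x * F i₀ (x i₀)) i₀]
      exact sum_congr rfl fun x _ => by rw [hinv, Function.update_self]
    rw [sum_congr rfl fun x _ => hleft x, sum_congr rfl fun x _ => hright x, ← sum_div,
      sum_add_distrib, hswap]
    ring

/-- The product `∏ cos (2π x_i ξ_i)`. -/
def cosProd (ξ : Fin d → ℝ) (x : Fin d → ℤ) : ℝ := ∏ i, Real.cos (2 * Real.pi * x i * ξ i)

lemma abs_cosProd_le_one (ξ : Fin d → ℝ) (x : Fin d → ℤ) : |cosProd ξ x| ≤ 1 := by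
  rw [cosProd, abs_prod]
  exact prod_le_one (fun _ _ => abs_nonneg _) fun _ _ => Real.abs_cos_le_one _

/-- The character factors over the coordinates, and the even part of each factor is a cosine. -/
lemma mult_eq (ξ : Fin d → ℝ) :
    mult q N ξ
      = ((1 / (ballFinset hq d N).card * ∑ x ∈ ballFinset hq d N, cosProd ξ x : ℝ) : ℂ) := by
  have hfin := latticeBall_finite hq d (Nat.cast_nonneg (α := ℝ) N)
  rw [mult, finsum_mem_eq_finite_toFinset_sum _ hfin, Set.ncard_eq_toFinset_card _ hfin]
  change (1 / ((ballFinset hq d N).card : ℂ)) *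
    ∑ x ∈ ballFinset hq d N, e (∑ i, (x i : ℝ) * ξ i) = _
  have h1 : ∀ x : Fin d → ℤ, e (∑ i, (x i : ℝ) * ξ i)
      = ∏ i, Complex.exp (2 * Real.pi * Complex.I * ((x i : ℝ) * ξ i : ℝ)) := by
    intro x
    rw [e, ← Complex.exp_sum, Complex.ofReal_sum, mul_sum]
  rw [sum_congr rfl fun x _ => h1 x,
    sum_ballFinset_prod_even hq
      (fun i j => Complex.exp (2 * Real.pi * Complex.I * ((j : ℝ) * ξ i : ℝ)))]
  push_cast
  congr 1
  refine sum_congr rfl fun x _ => ?_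
  rw [cosProd, Complex.ofReal_prod]
  refine prod_congr rfl fun i _ => ?_
  rw [Complex.ofReal_cos, Complex.cos]
  push_cast
  congr 3 <;> ring_nf

lemma lambda2_eq (ξ : Fin d → ℝ) :
    lambda2 q N ξ
      = ((1 / (ballFinset hq d N).card * ∑ x ∈ ballFinset hq d N, (-1 : ℝ) ^ (∑ i, x i)
          * Real.exp (-(kappa q d N ^ q * tnorm (halfShift ξ) ^ 2)) : ℝ) : ℂ) := by
  have hfin := latticeBall_finite hq d (Nat.cast_nonneg (α := ℝ) N)
  rw [lambda2, finsum_mem_eq_finite_toFinset_sum _ hfin, Set.ncard_eq_toFinset_card _ hfin]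
  change (1 / ((ballFinset hq d N).card : ℂ)) *
    (∑ x ∈ ballFinset hq d N, (-1 : ℂ) ^ (∑ i, x i)) * _ = _
  rw [← sum_mul]
  push_cast
  ring

end Symmetrization

/-! ### Trigonometric inequalities and the half shift. -/

section Trigonometry

variable {d : ℕ}

lemma abs_sin_nat_mul_le (n : ℕ) (θ : ℝ) : |Real.sin (n * θ)| ≤ n * |Real.sin θ| := by
  induction n with
  | zero => simp
  | succ n ih =>
    push_cast
    rw [add_mul, one_mul, Real.sin_add]
    calc |Real.sin (n * θ) * Real.cos θ + Real.cos (n * θ) * Real.sin θ|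
        ≤ |Real.sin (n * θ)| * |Real.cos θ| + |Real.cos (n * θ)| * |Real.sin θ| := by
          rw [← abs_mul, ← abs_mul]; exact abs_add_le _ _
      _ ≤ |Real.sin (n * θ)| * 1 + 1 * |Real.sin θ| := by
          gcongr <;> exact Real.abs_cos_le_one _
      _ ≤ (n + 1) * |Real.sin θ| := by linarith

lemma sin_int_mul_sq_le (j : ℤ) (θ : ℝ) : Real.sin (j * θ) ^ 2 ≤ (j : ℝ) ^ 2 * Real.sin θ ^ 2 := by
  have h : |Real.sin (j * θ)| ≤ |(j : ℝ)| * |Real.sin θ| := by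
    have h1 := abs_sin_nat_mul_le j.natAbs θ
    rw [Nat.cast_natAbs, Int.cast_abs] at h1
    refine le_trans (le_of_eq ?_) h1
    rcases abs_choice (j : ℝ) with h | h <;> rw [h]
    rw [neg_mul, Real.sin_neg, abs_neg]
  rw [← abs_mul] at h
  rw [← mul_pow]
  exact sq_le_sq.2 h

lemma one_sub_cos_eq (θ : ℝ) : 1 - Real.cos (2 * θ) = 2 * Real.sin θ ^ 2 := by
  rw [Real.cos_two_mul, Real.cos_sq']; ring

lemma abs_one_sub_prod_le {ι : Type*} (s : Finset ι) {c : ι → ℝ} (hc : ∀ i, |c i| ≤ 1) :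
    |1 - ∏ i ∈ s, c i| ≤ ∑ i ∈ s, (1 - c i) := by
  classical
  induction s using Finset.induction_on with
  | empty => simp
  | insert i s hi ih =>
    rw [prod_insert hi, sum_insert hi]
    have h1 : 1 - c i * ∏ j ∈ s, c j = (1 - c i) + c i * (1 - ∏ j ∈ s, c j) := by ring
    have h0 : 0 ≤ 1 - c i := by linarith [(abs_le.1 (hc i)).2]
    rw [h1]
    refine (abs_add_le _ _).trans ?_
    rw [abs_of_nonneg h0, abs_mul]
    have := mul_le_of_le_one_left (abs_nonneg (1 - ∏ j ∈ s, c j)) (hc i)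
    linarith

lemma abs_one_sub_cosProd_le (ξ : Fin d → ℝ) (x : Fin d → ℤ) :
    |1 - cosProd ξ x| ≤ ∑ i, 2 * Real.sin (Real.pi * ξ i) ^ 2 * (x i : ℝ) ^ 2 := by
  refine (abs_one_sub_prod_le univ fun i => Real.abs_cos_le_one _).trans ?_
  refine sum_le_sum fun i _ => ?_
  rw [show 2 * Real.pi * x i * ξ i = 2 * (x i * (Real.pi * ξ i)) by ring, one_sub_cos_eq]
  linarith [sin_int_mul_sq_le (x i) (Real.pi * ξ i)]

lemma tnorm_sq (ξ : Fin d → ℝ) : tnorm ξ ^ 2 = ∑ j, Real.sin (Real.pi * ξ j) ^ 2 :=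
  Real.sq_sqrt (sum_nonneg fun _ _ => sq_nonneg _)

lemma sum_one_sub_cos (ξ : Fin d → ℝ) :
    ∑ u, (1 - Real.cos (2 * Real.pi * ξ u)) = 2 * tnorm ξ ^ 2 := by
  rw [tnorm_sq, mul_sum]
  exact sum_congr rfl fun u _ => by rw [mul_assoc, one_sub_cos_eq]

lemma sum_one_add_cos (ξ : Fin d → ℝ) :
    ∑ u, (1 + Real.cos (2 * Real.pi * ξ u)) = 2 * tnorm (halfShift ξ) ^ 2 := by
  rw [← sum_one_sub_cos]
  refine sum_congr rfl fun u _ => ?_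
  rw [halfShift, mul_add, show 2 * Real.pi * (1 / 2) = Real.pi by ring, Real.cos_add_pi]
  ring

/-- The shift adds `x_i π` to the `i`-th angle. This identity reduces the second case to the first.
-/
lemma cosProd_halfShift (ξ : Fin d → ℝ) (x : Fin d → ℤ) :
    (-1 : ℝ) ^ (∑ i, x i) * cosProd (halfShift ξ) x = cosProd ξ x := by
  have hz : (-1 : ℝ) ^ (∑ i, x i) = ∏ i, (-1 : ℝ) ^ (x i) := by
    have : ∀ s : Finset (Fin d), (-1 : ℝ) ^ (∑ i ∈ s, x i) = ∏ i ∈ s, (-1 : ℝ) ^ (x i) := by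
      intro s
      induction s using Finset.induction_on with
      | empty => simp
      | insert i s hi ih => rw [sum_insert hi, prod_insert hi, zpow_add₀ (by norm_num), ih]
    exact this univ
  rw [hz, cosProd, cosProd, ← prod_mul_distrib]
  refine prod_congr rfl fun i _ => ?_
  rw [← Real.cos_sub_int_mul_pi, halfShift]
  congr 1
  ring

end Trigonometry

/-! ### The two regimes and their combination. -/

section Estimates

variable {q : ℝ} (hq : 1 ≤ q) {d N : ℕ}

lemma sum_abs_one_sub_cosProd_le (hd : 1 ≤ d) (hN : 1 ≤ N) (hK : dens q d N ≤ 1 / 1000)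
    (ξ : Fin d → ℝ) :
    ∑ x ∈ ballFinset hq d N, |1 - cosProd ξ x|
      ≤ 64 * (dens q d N * tnorm ξ ^ 2) * (ballFinset hq d N).card := by
  calc ∑ x ∈ ballFinset hq d N, |1 - cosProd ξ x|
      ≤ ∑ x ∈ ballFinset hq d N, ∑ i, 2 * Real.sin (Real.pi * ξ i) ^ 2 * (x i : ℝ) ^ 2 :=
        sum_le_sum fun x _ => abs_one_sub_cosProd_le ξ x
    _ = ∑ i, 2 * Real.sin (Real.pi * ξ i) ^ 2 * ∑ x ∈ ballFinset hq d N, (x i : ℝ) ^ 2 := by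
        rw [sum_comm]
        exact sum_congr rfl fun i _ => (mul_sum _ _ _).symm
    _ ≤ ∑ i, 2 * Real.sin (Real.pi * ξ i) ^ 2 * (32 * dens q d N * (ballFinset hq d N).card) :=
        sum_le_sum fun i _ =>
          mul_le_mul_of_nonneg_left (sum_coord_sq_le hq hd hN hK i) (by positivity)
    _ = _ := by
        rw [← sum_mul, ← mul_sum, ← tnorm_sq]; ring

lemma exists_injOn_mapsTo {α : Type*} {s t : Finset α} (h : s.card ≤ t.card) :
    ∃ φ : α → α, Set.InjOn φ s ∧ ∀ i ∈ s, φ i ∈ t := by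
  classical
  obtain ⟨f⟩ := Function.Embedding.nonempty_of_card_le (α := s) (β := t) (by simpa using h)
  refine ⟨fun i => if hi : i ∈ s then f ⟨i, hi⟩ else i, ?_, ?_⟩
  · intro i hi j hj hij
    have hi' : i ∈ s := hi
    have hj' : j ∈ s := hj
    simp only [hi', hj', dif_pos] at hij
    simpa using f.injective (Subtype.ext hij)
  · intro i hi
    simp [hi]

/-- Coordinates `±1` all give the factor `cos (2π ξ_u)`, by evenness, and zeros give `1`. Supports
have at most `N^q ≤ d / 1000` elements, so there are enough zeros to pair with. -/
lemma sum_perm_cos_le (hd : 1 ≤ d) (hN : 1 ≤ N) (hK : dens q d N ≤ 1 / 1000)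
    (ξ : Fin d → ℝ) {t : ℝ} (ht : 0 < t) (h1 : t ^ 2 ≤ tnorm ξ ^ 2)
    (h2 : t ^ 2 ≤ tnorm (halfShift ξ) ^ 2) {x : Fin d → ℤ} (hx : x ∈ ballFinset hq d N)
    (hones : (N : ℝ) ^ q / 2 ≤ (ones x).card) :
    |∑ σ : Equiv.Perm (Fin d), ∏ i, Real.cos (2 * Real.pi * x i * ξ (σ i))|
      ≤ Fintype.card (Equiv.Perm (Fin d)) * (48 / (dens q d N * t ^ 2) + 32 / (N : ℝ) ^ q) := by
  have hbig := d_large hd hK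
  have hn1 := one_le_pow_q hq hN
  have hd20 : 20 ≤ d := by
    have : (20 : ℝ) ≤ d := by linarith
    exact_mod_cast this
  have hd0 : (0 : ℝ) < d := by exact_mod_cast hd
  have hsupp : ((univ.filter fun i => x i ≠ 0).card : ℝ) ≤ (N : ℝ) ^ q :=
    (card_support_le_qsum hq x).trans ((mem_ballFinset hq).1 hx)
  have hcount : (univ.filter fun i => x i = 0).card + (univ.filter fun i => x i ≠ 0).card = d := by
    rw [card_filter_add_card_filter_not, card_univ, Fintype.card_fin]
  have hle : (ones x).card ≤ (univ.filter fun i => x i ≠ 0).card := by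
    refine card_le_card fun i hi => ?_
    have : (x i).natAbs = 1 := by simpa [ones] using hi
    simp only [mem_filter, mem_univ, true_and]
    omega
  have hle2 : (ones x).card ≤ (univ.filter fun i => x i = 0).card := by
    have e1 : ((univ.filter fun i => x i = 0).card : ℝ)
        + (univ.filter fun i => x i ≠ 0).card = d := by exact_mod_cast hcount
    have e2 : ((ones x).card : ℝ) ≤ (univ.filter fun i => x i ≠ 0).card := by exact_mod_cast hle
    have : ((ones x).card : ℝ) ≤ (univ.filter fun i => x i = 0).card := by linarith
    exact_mod_cast this
  obtain ⟨φ, hφ, hmaps⟩ := exists_injOn_mapsTo hle2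
  have hzero : ∀ i ∈ ones x, x (φ i) = 0 := fun i hi => by simpa using hmaps i hi
  have key := abs_sum_perm_prod_le hd20 (f := fun i u => Real.cos (2 * Real.pi * x i * ξ u))
    (a := fun u => Real.cos (2 * Real.pi * ξ u)) (fun u => Real.abs_cos_le_one _)
    (fun i u => Real.abs_cos_le_one _) hφ
    (fun i hi h => by
      have h3 := hzero i hi
      simp [ones, h3] at h)
    (fun i hi u => by
      have h3 : (x i).natAbs = 1 := by simpa [ones] using hi
      rcases Int.natAbs_eq (x i) with h | h <;> rw [h, h3] <;> simp)
    (fun i hi u => by simp [hzero i hi])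
    (D := 2 * t ^ 2) (g := (N : ℝ) ^ q / 2)
    (by rw [sum_one_sub_cos]; linarith) (by rw [sum_one_add_cos]; linarith)
    (by positivity) (by linarith) hones
  refine key.trans (mul_le_mul_of_nonneg_left ?_ (by positivity))
  refine add_le_add (le_of_eq ?_) ?_
  · rw [dens]
    have : (N : ℝ) ^ q ≠ 0 := by linarith
    field_simp
  · gcongr
    linarith

lemma abs_sum_cosProd_le (hd : 1 ≤ d) (hN : 1 ≤ N) (hK : dens q d N ≤ 1 / 1000)
    (h4 : 4 ≤ (N : ℝ) ^ q) (ξ : Fin d → ℝ) {t : ℝ} (ht : 0 < t) (h1 : t ^ 2 ≤ tnorm ξ ^ 2)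
    (h2 : t ^ 2 ≤ tnorm (halfShift ξ) ^ 2) :
    |∑ x ∈ ballFinset hq d N, cosProd ξ x|
      ≤ (1026 * dens q d N + 48 / (dens q d N * t ^ 2) + 32 / (N : ℝ) ^ q)
        * (ballFinset hq d N).card := by
  classical
  set B := ballFinset hq d N with hB
  set p : ℝ := (Fintype.card (Equiv.Perm (Fin d)) : ℝ) with hp
  have hp0 : 0 < p := by rw [hp]; exact_mod_cast Fintype.card_pos
  set G : (Fin d → ℤ) → ℝ := fun x =>
    ∑ σ : Equiv.Perm (Fin d), ∏ i, Real.cos (2 * Real.pi * x i * ξ (σ i)) with hG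
  set b := 48 / (dens q d N * t ^ 2) + 32 / (N : ℝ) ^ q with hb
  have hb0 : 0 ≤ b := by
    have := dens_nonneg (q := q) (d := d) (N := N)
    positivity
  -- Permuting the point is traded for permuting the frequencies.
  have hsym : p * ∑ x ∈ B, cosProd ξ x = ∑ x ∈ B, G x := by
    rw [hG, sum_comm, hp, ← card_univ, ← nsmul_eq_mul, ← sum_const]
    refine sum_congr rfl fun σ _ => ?_
    rw [← sum_ballFinset_comp_perm hq
      (fun x => ∏ i, Real.cos (2 * Real.pi * x i * ξ (σ i))) σ]
    refine sum_congr rfl fun x _ => ?_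
    exact (Equiv.prod_comp σ fun i => Real.cos (2 * Real.pi * x i * ξ i)).symm
  have hGle : ∀ x ∈ B, |G x| ≤ p * b + if ((ones x).card : ℝ) < (N : ℝ) ^ q / 2 then p else 0 := by
    intro x hx
    split_ifs with h
    · have : |G x| ≤ p := by
        refine (abs_sum_le_sum_abs _ _).trans ?_
        refine (sum_le_card_nsmul univ _ 1 fun σ _ => ?_).trans (by simp [hp])
        rw [abs_prod]
        exact prod_le_one (fun _ _ => abs_nonneg _) fun _ _ => Real.abs_cos_le_one _
      nlinarith [mul_nonneg hp0.le hb0]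
    · rw [add_zero]
      exact sum_perm_cos_le hq hd hN hK ξ ht h1 h2 hx (not_lt.1 h)
  have hfew := card_few_ones_le hq hd hN hK h4
  have hfin : p * |∑ x ∈ B, cosProd ξ x| ≤ p * (b * B.card + 1026 * dens q d N * B.card) := by
    calc p * |∑ x ∈ B, cosProd ξ x| = |∑ x ∈ B, G x| := by
          rw [← hsym, abs_mul, abs_of_pos hp0]
      _ ≤ ∑ x ∈ B, |G x| := abs_sum_le_sum_abs _ _
      _ ≤ ∑ x ∈ B, (p * b + if ((ones x).card : ℝ) < (N : ℝ) ^ q / 2 then p else 0) :=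
          sum_le_sum hGle
      _ = p * (b * B.card + (B.filter fun x => ((ones x).card : ℝ) < (N : ℝ) ^ q / 2).card) := by
          rw [sum_add_distrib, ← sum_filter, sum_const, sum_const, nsmul_eq_mul, nsmul_eq_mul]
          ring
      _ ≤ _ := by gcongr
  have := le_of_mul_le_mul_left hfin hp0
  calc _ ≤ _ := this
    _ = _ := by rw [hb]; ring

/-- The approximation of an average of `cosProd ξ = c * cosProd η` by the average of `c` times a
Gaussian factor in `η`. -/
lemma abs_average_sub_le (hd : 1 ≤ d) (hN : 1 ≤ N) (hK : dens q d N ≤ 1 / 1000)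
    {ξ η : Fin d → ℝ} {c : (Fin d → ℤ) → ℝ} (hc : ∀ x, |c x| ≤ 1)
    (hcη : ∀ x, c x * cosProd η x = cosProd ξ x) (h1 : tnorm η ≤ tnorm ξ)
    (h2 : tnorm η ≤ tnorm (halfShift ξ)) {s : ℝ} (hs : s = dens q d N * tnorm η ^ 2) :
    |1 / (ballFinset hq d N).card * ∑ x ∈ ballFinset hq d N, cosProd ξ x
        - 1 / (ballFinset hq d N).card * ∑ x ∈ ballFinset hq d N, c x * Real.exp (-s)|
      ≤ 2000 * (min s s⁻¹ + dens q d N + 1 / (N : ℝ) ^ q) := by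
  set B := ballFinset hq d N with hB
  have hBpos : 0 < (B.card : ℝ) := card_ballFinset_pos hq
  have hK0 : 0 ≤ dens q d N := dens_nonneg
  have hn1 := one_le_pow_q hq hN
  have hn0 : 0 ≤ 1 / (N : ℝ) ^ q := by positivity
  have hs0 : 0 ≤ s := by rw [hs]; positivity
  have hE0 : 0 < Real.exp (-s) := Real.exp_pos _
  have hE1 : Real.exp (-s) ≤ 1 := Real.exp_le_one_iff.2 (by linarith)
  have hEs : 1 - Real.exp (-s) ≤ s := by linarith [Real.add_one_le_exp (-s)]
  have hce : ∀ x, |c x * Real.exp (-s)| ≤ Real.exp (-s) := fun x => by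
    rw [abs_mul, abs_of_pos hE0]
    exact mul_le_of_le_one_left hE0.le (hc x)
  have hdiff : |1 / (B.card : ℝ) * ∑ x ∈ B, cosProd ξ x
      - 1 / (B.card : ℝ) * ∑ x ∈ B, c x * Real.exp (-s)| = 1 / B.card *
        |∑ x ∈ B, cosProd ξ x - ∑ x ∈ B, c x * Real.exp (-s)| := by
    rw [← mul_sub, abs_mul, abs_of_pos (by positivity)]
  set X := |∑ x ∈ B, cosProd ξ x - ∑ x ∈ B, c x * Real.exp (-s)| with hX
  rw [hdiff, one_div, ← div_eq_inv_mul, div_le_iff₀ hBpos]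
  -- Both `cosProd η` on average and `exp (-s)` are compared with `1`, at costs `64 s` and `s`.
  have hsmall : X ≤ 65 * s * B.card := by
    have hterm : ∀ x ∈ B, |cosProd ξ x - c x * Real.exp (-s)| ≤ |1 - cosProd η x| + s := by
      intro x _
      rw [← hcη, ← mul_sub, abs_mul]
      refine (mul_le_of_le_one_left (abs_nonneg _) (hc x)).trans ?_
      have : cosProd η x - Real.exp (-s) = -(1 - cosProd η x) + (1 - Real.exp (-s)) := by ring
      rw [this]
      refine (abs_add_le _ _).trans ?_
      rw [abs_neg, abs_of_nonneg (by linarith : 0 ≤ 1 - Real.exp (-s))]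
      linarith
    calc X ≤ ∑ x ∈ B, |cosProd ξ x - c x * Real.exp (-s)| := by
          rw [hX, ← sum_sub_distrib]; exact abs_sum_le_sum_abs _ _
      _ ≤ ∑ x ∈ B, (|1 - cosProd η x| + s) := sum_le_sum hterm
      _ = ∑ x ∈ B, |1 - cosProd η x| + B.card * s := by
          rw [sum_add_distrib, sum_const, nsmul_eq_mul]
      _ ≤ 64 * s * B.card + B.card * s := by
          have := sum_abs_one_sub_cosProd_le hq hd hN hK η
          rw [hs]; linarith
      _ = _ := by ring
  have hsplit : X ≤ |∑ x ∈ B, cosProd ξ x| + Real.exp (-s) * B.card := by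
    refine (abs_sub _ _).trans (add_le_add_right ?_ _)
    refine (abs_sum_le_sum_abs _ _).trans ?_
    refine (sum_le_sum fun x _ => hce x).trans (le_of_eq ?_)
    rw [sum_const, nsmul_eq_mul, mul_comm]
  -- At `s = 0` the inverse is `0`, so the minimum vanishes; the bound `65 s` still suffices.
  rcases hs0.eq_or_lt with hs' | hs'
  · rw [← hs'] at hsmall
    have : 0 ≤ 2000 * (min s s⁻¹ + dens q d N + 1 / (N : ℝ) ^ q) * B.card := by
      rw [← hs']; simp; positivity
    linarith
  -- When `N^q < 4` the term `1 / N^q` exceeds `1/4` and pays for the trivial bound `2`.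
  rcases lt_or_ge ((N : ℝ) ^ q) 4 with h4 | h4
  · have htriv : |∑ x ∈ B, cosProd ξ x| ≤ B.card := by
      refine (abs_sum_le_sum_abs _ _).trans ?_
      refine (sum_le_card_nsmul B _ 1 fun x _ => abs_cosProd_le_one ξ x).trans (by simp)
    have hq4 : 1 / 4 ≤ 1 / (N : ℝ) ^ q := one_div_le_one_div_of_le (by linarith) h4.le
    have hmin : 0 ≤ min s s⁻¹ := le_min hs0 (inv_nonneg.2 hs0)
    calc X ≤ B.card + Real.exp (-s) * B.card := by linarith
      _ ≤ 2 * B.card := by nlinarith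
      _ ≤ _ := by gcongr; linarith
  · have ht : 0 < tnorm η := by
      have hη : 0 ≤ tnorm η := Real.sqrt_nonneg _
      rcases hη.eq_or_lt with h | h
      · rw [hs, ← h] at hs'; simp at hs'
      · exact h
    have hdecay := abs_sum_cosProd_le hq hd hN hK h4 ξ ht
      (pow_le_pow_left₀ ht.le h1 2) (pow_le_pow_left₀ ht.le h2 2)
    rw [← hs] at hdecay
    have hE := exp_neg_le_inv hs'
    have hlarge : X ≤ (1026 * dens q d N + 49 * s⁻¹ + 32 * (1 / (N : ℝ) ^ q)) * B.card := by
      have e1 : (1026 * dens q d N + 48 / s + 32 / (N : ℝ) ^ q) * (B.card : ℝ)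
          = (1026 * dens q d N + 48 * s⁻¹ + 32 * (1 / (N : ℝ) ^ q)) * B.card := by
        rw [div_eq_mul_inv, div_eq_mul_inv 32, one_div]
      have e2 : Real.exp (-s) * B.card ≤ s⁻¹ * B.card := by gcongr
      rw [e1] at hdecay
      linarith
    rcases le_total s s⁻¹ with h | h
    · rw [min_eq_left h]
      exact hsmall.trans (mul_le_mul_of_nonneg_right (by linarith) hBpos.le)
    · rw [min_eq_right h]
      have : 0 < s⁻¹ := inv_pos.2 hs'
      exact hlarge.trans (mul_le_mul_of_nonneg_right (by linarith) hBpos.le)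

lemma kappa_rpow (q : ℝ) (hq : 1 ≤ q) (d N : ℕ) : kappa q d N ^ q = dens q d N := by
  have hq0 : q ≠ 0 := by linarith
  rw [kappa, dens, Real.div_rpow (by positivity) (by positivity), ← Real.rpow_mul (by positivity),
    one_div_mul_cancel hq0, Real.rpow_one]

lemma dens_le_of_kappa_le {q : ℝ} (hq : 1 ≤ q) {d N : ℕ}
    (h : kappa q d N ≤ Real.exp (-12 / q)) : dens q d N ≤ 1 / 1000 := by
  have hq0 : q ≠ 0 := by linarith
  have hk0 : 0 ≤ kappa q d N := by unfold kappa; positivity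
  have h1 := Real.rpow_le_rpow hk0 h (by linarith : 0 ≤ q)
  rw [kappa_rpow q hq, ← Real.exp_mul, div_mul_cancel₀ _ hq0] at h1
  refine h1.trans ?_
  rw [Real.exp_neg, ← one_div]
  refine one_div_le_one_div_of_le (by norm_num) ?_
  -- From `e ≥ 2`, `exp 12 ≥ 4096 > 1000`.
  have h2 : (2 : ℝ) ^ 12 ≤ Real.exp 1 ^ 12 :=
    pow_le_pow_left₀ (by norm_num) (by linarith [Real.add_one_le_exp (1 : ℝ)]) 12
  rw [← Real.exp_nat_mul] at h2
  norm_num at h2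
  linarith

/-- The argument yields the stronger error `κ^q`; since `κ ≤ 1`, lowering the exponent only enlarges
it. -/
lemma dens_le_kappa_rpow {q : ℝ} (hq : 1 ≤ q) {d N : ℕ} (hd : 1 ≤ d) (hN : 1 ≤ N)
    (h : kappa q d N ≤ Real.exp (-12 / q)) : dens q d N ≤ kappa q d N ^ (q / 50) := by
  have hk0 : 0 < kappa q d N := by
    have : (0 : ℝ) < d := by exact_mod_cast hd
    have : (0 : ℝ) < N := by exact_mod_cast hN
    unfold kappa; positivity
  have hk1 : kappa q d N ≤ 1 := h.trans (Real.exp_le_one_iff.2 (by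
    apply div_nonpos_of_nonpos_of_nonneg <;> linarith))
  rw [← kappa_rpow q hq]
  exact Real.rpow_le_rpow_of_exponent_ge hk0 hk1 (by linarith)

end Estimates

end LqBall

end

theorem proposition4p3 :
    ∃ C : ℝ, 0 < C ∧
      ∀ (q : ℝ) (d N : ℕ), 1 ≤ q → 1 ≤ d → 1 ≤ N →
        LqBall.kappa q d N ≤ Real.exp (-12 / q) →
        ∀ ξ ∈ LqBall.torus d,
          (LqBall.tnorm ξ ≤ LqBall.tnorm (LqBall.halfShift ξ) →
            ‖LqBall.mult q N ξ - LqBall.lambda1 q N ξ‖ ≤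
              C * (min (LqBall.kappa q d N ^ q * LqBall.tnorm ξ ^ 2)
                    (LqBall.kappa q d N ^ q * LqBall.tnorm ξ ^ 2)⁻¹
                  + LqBall.kappa q d N ^ (q / 50) + 1 / (N : ℝ) ^ q)) ∧
          (LqBall.tnorm (LqBall.halfShift ξ) < LqBall.tnorm ξ →
            ‖LqBall.mult q N ξ - LqBall.lambda2 q N ξ‖ ≤
              C * (min (LqBall.kappa q d N ^ q * LqBall.tnorm (LqBall.halfShift ξ) ^ 2)
                    (LqBall.kappa q d N ^ q * LqBall.tnorm (LqBall.halfShift ξ) ^ 2)⁻¹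
                  + LqBall.kappa q d N ^ (q / 50) + 1 / (N : ℝ) ^ q)) := by
  refine ⟨2000, by norm_num, fun q d N hq hd hN hκ ξ _ => ?_⟩
  have hK := LqBall.dens_le_of_kappa_le hq hκ
  have hKκ := LqBall.dens_le_kappa_rpow hq hd hN hκ
  have hB := LqBall.card_ballFinset_pos hq (d := d) (N := N)
  have hκq := LqBall.kappa_rpow q hq d N
  refine ⟨fun h => ?_, fun h => ?_⟩
  · have key := LqBall.abs_average_sub_le hq hd hN hK (ξ := ξ) (η := ξ) (c := fun _ => 1)
      (fun _ => by simp) (fun _ => one_mul _) le_rfl h rfl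
    have hl : LqBall.lambda1 q N ξ = ((1 / (LqBall.ballFinset hq d N).card *
        ∑ x ∈ LqBall.ballFinset hq d N,
          1 * Real.exp (-(LqBall.dens q d N * LqBall.tnorm ξ ^ 2)) : ℝ) : ℂ) := by
      rw [LqBall.lambda1, hκq, Finset.sum_const, nsmul_eq_mul, one_mul, ← mul_assoc,
        one_div_mul_cancel hB.ne', one_mul]
    rw [LqBall.mult_eq hq, hl, ← Complex.ofReal_sub, Complex.norm_real, Real.norm_eq_abs, hκq]
    exact key.trans (by linarith)
  · have key := LqBall.abs_average_sub_le hq hd hN hK (ξ := ξ) (η := LqBall.halfShift ξ)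
      (c := fun x => (-1 : ℝ) ^ (∑ i, x i)) (fun _ => by simp [abs_zpow])
      (fun x => LqBall.cosProd_halfShift ξ x) h.le le_rfl rfl
    rw [LqBall.mult_eq hq, LqBall.lambda2_eq hq, ← Complex.ofReal_sub, Complex.norm_real,
      Real.norm_eq_abs, hκq]
    exact key.trans (by linarith)
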